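/- **Model.** Let $L\ge 1$. On a probability space let $Y_0,Y_1,V,\Theta$ be real random variables, $Z,\Gamma$ random vectors in $\mathbb R^{L-1}$ (dropped when $L=1$), and $X_0,X_1$ random vectors in $\mathbb R^k$. Put $\Delta=Y_1-Y_0$, $D=\mathbf 1\{V-Z'\Gamma-\Theta>0\}$, $Y=Y_0+\Delta D$, $X=X_1$ if $D=1$ and $X=X_0$ if $D=0$, and $\widetilde S=(Z',1)'/\|(Z',1)\|$, $\widetilde V=V/\|(Z',1)\|$, $\widetilde\Gamma=(\Gamma',\Theta)'$. The observables are $(Y,D,V,Z,X)$. Let $H^+=\{s\in\mathbb S^{L-1}: s_L>0\}$. **Assumption 1.** (i) For almost every $x$ the conditional law of $(\widetilde S,\widetilde V,\widetilde\Gamma)$ given $X=x$ is absolutely continuous with respect to the product of the spherical measure on $\mathbb S^{L-1}$ and Lebesgue measure on $\mathbb R^{L+1}$; (ii) given $X$, $(V,Z)$ is independent of $(Y_0,\Gamma,\Theta)$ and $(V,Z)$ is independent of $(Y_1,\Gamma,\Theta)$; (iii) $0<\mathbb P(D=1\mid X)<1$ a.s.; (iv) $X_0=X_1$ a.s. **Assumption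 2 (large support).** For almost every $x$: if $L=1$, $\mathrm{supp}(V\mid X=x)\supset\mathrm{supp}(\Theta\mid X=x)$. If $L\ge2$, $\mathrm{supp}(\widetilde S\mid X=x)=\overline{H^+}$ and, for almost every $s$ under the conditional law of $\widetilde S$ given $X=x$, $\mathrm{supp}(\widetilde V\mid \widetilde S=s,X=x)$ contains all real numbers between $\inf s'\gamma$ and $\sup s'\gamma$, where $\gamma$ runs through $\mathrm{supp}(\widetilde\Gamma\mid X=x)$. **Notation.** $\mathrm{UCATE}(\theta,x)=\mathbb E[\Delta\mid\Theta=\theta,X=x]$ for $L=1$ and $\mathrm{UCATE}(\gamma,x)=\mathbb E[\Delta\mid\widetilde\Gamma=\gamma,X=x]$ for $L\ge2$. A bar denotes extension by $0$: of UCATE outside the support of $\Theta$ (of $\widetilde\Gamma$) given $X=x$, and of the derivative of a regression function outside the support of the regressors given $X=x$. $R[f](s,u)$ is the integral of $f\in L^1(\mathbb R^L)$ over the hyperplane $\{\gamma:s'\gamma=u\}$, for $s\in H^+$ and $u\in\mathbb R$; $R^{-1}[g]$ is the unique (up to null sets) $f\in L^1(\mathbb R^L)$ such that $R[f](s,u)=g(s,u)$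 for almost every $s\in H^+$ and almost every $u$. Regression functions of $Y$ are taken in a measurable version which, for almost every $x$, is continuous in the instruments on their support given $X=x$; the values on that support do not depend on the version, for almost every $x$. The derivative $\partial_v$ at a point is taken along the points $v$ of the support (of its section at $s$ when $L\ge2$). **Theorem.** Suppose that Assumption 1 holds and $\mathbb E[|Y_1|+|Y_0|]<\infty$. (a) Let $L=1$. Such a version of $\mathbb E[Y\mid V=v,X=x]$ exists, and for every such version, for almost every $x$ and almost every $\theta\in\mathrm{supp}(V\mid X=x)$, it is differentiable in $v$ at $\theta$ and $$\overline{\mathrm{UCATE}(\theta,x)}\,f_{\Theta|X}(\theta|x)=\partial_v\mathbb E[Y\mid V=\cdot,X=x](\theta).$$ Under Assumption 2 the equality, with $\overline{\partial_v\mathbb E[Y\mid V=\cdot,X=x]}$ on the right, holds for almost every $\theta\in\mathbb R$. (b) Let $L\ge2$ and let Assumption 2 hold. Such a version of $\mathbb E[Y\mid\widetilde S=s,\widetilde V=v,X=x]$ exists, and for every such version, for almost every $x$: for every $s\in H^+$ it is differentiable in $v$ at almost every $v$ with $(s,v)\in\mathrm{supp}((\widetilde S,\widetilde V)\mid X=x)$;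 the function $\overline{\partial_v\mathbb E[Y\mid(\widetilde S,\widetilde V)=\cdot,X=x]}$ is in the domain of $R^{-1}$; and for almost every $\gamma\in\mathbb R^L$ $$\overline{\mathrm{UCATE}(\gamma,x)}\,f_{\widetilde\Gamma|X}(\gamma|x)=R^{-1}\Big[\overline{\partial_v\mathbb E[Y\mid(\widetilde S,\widetilde V)=\cdot,X=x]}\Big](\gamma).$$ (c) Consequently UCATE is identified: if two models satisfying the assumptions above (including Assumption 2 when $L\ge2$) have the same law of observables, then for almost every $x$, for almost every $\theta\in\mathrm{supp}(V\mid X=x)$ when $L=1$ and almost every $\gamma\in\mathbb R^L$ when $L\ge2$, the conditional densities of $\Theta$ (of $\widetilde\Gamma$) given $X=x$ coincide there, and where this density is positive the values of UCATE coincide. -/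

import Mathlib

open MeasureTheory ProbabilityTheory Set

noncomputable section

/-- `ℝⁿ` with its Euclidean norm. -/
abbrev Eucl (n : ℕ) : Type := EuclideanSpace ℝ (Fin n)

/-- The vector `(z, t) ∈ ℝ^{m+1}` obtained by appending the number `t` to `z ∈ ℝ^m`. -/
def appendCoord {m : ℕ} (z : Eucl m) (t : ℝ) : Eucl (m + 1) :=
  WithLp.toLp 2 (Fin.snoc (α := fun _ => ℝ) (fun i => z i) t)

/-! ### The sphere and the Radon transform -/

/-- The spherical measure on the unit sphere of `ℝ^{m+1}`, as a measure on `ℝ^{m+1}`. -/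
def sphereMeasure (m : ℕ) : Measure (Eucl (m + 1)) :=
  (volume : Measure (Eucl (m + 1))).toSphere.map Subtype.val

/-- The open hemisphere `H⁺` of unit vectors with positive last coordinate. -/
def hemisphere (m : ℕ) : Set (Eucl (m + 1)) :=
  {s | ‖s‖ = 1 ∧ 0 < s (Fin.last m)}

/-- The Radon transform: the integral of `f` over the hyperplane `{γ | ⟪s, γ⟫ = u}`, for a unit
vector `s`, with respect to Lebesgue measure on that hyperplane. The hyperplane is parametrized
isometrically by the orthogonal complement of `s`. -/
def radon {m : ℕ} (f : Eucl (m + 1) → ℝ) (s : Eucl (m + 1)) (u : ℝ) : ℝ :=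
  ∫ w : (Submodule.span ℝ {s})ᗮ, f (u • s + (w : Eucl (m + 1)))

/-- `f ∈ L¹(ℝ^{m+1})` and `R f = g` almost everywhere on `H⁺ × ℝ`. -/
def IsRadonPreimage {m : ℕ} (g : Eucl (m + 1) → ℝ → ℝ) (f : Eucl (m + 1) → ℝ) : Prop :=
  Integrable f ∧
    ∀ᵐ s ∂((sphereMeasure m).restrict (hemisphere m)), ∀ᵐ u : ℝ, radon f s u = g s u

/-- `g` is in the domain of `R⁻¹`: it is the Radon transform of one and, up to null sets, only one
function of `L¹(ℝ^{m+1})`. -/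
def HasRadonInverse {m : ℕ} (g : Eucl (m + 1) → ℝ → ℝ) : Prop :=
  ∃ f, IsRadonPreimage g f ∧ ∀ f', IsRadonPreimage g f' → f' =ᵐ[volume] f

open Classical in
/-- The inverse Radon transform `R⁻¹ g` (defined up to null sets; `0` by convention if `g` is not
in the domain of `R⁻¹`). -/
def radonInv {m : ℕ} (g : Eucl (m + 1) → ℝ → ℝ) : Eucl (m + 1) → ℝ :=
  if h : HasRadonInverse g then h.choose else 0

/-! ### The model -/

/-- The primitives of the random coefficients treatment effect model with `L = m + 1`
instruments `(V, Z) ∈ ℝ × ℝ^m`, unobserved coefficients `(Γ, Θ) ∈ ℝ^m × ℝ` in the selection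
equation, potential outcomes `Y₀, Y₁`, and potential values `X₀, X₁ ∈ ℝ^k` of the covariate.
For `L = 1` the vectors `Z` and `Γ` live in the zero space, i.e. they are dropped. -/
structure TreatmentModel (Ω : Type*) [MeasurableSpace Ω] (m k : ℕ) where
  P : Measure Ω
  isProb : IsProbabilityMeasure P
  Y₀ : Ω → ℝ
  Y₁ : Ω → ℝ
  V : Ω → ℝ
  Z : Ω → Eucl m
  Γ : Ω → Eucl m
  Θ : Ω → ℝ
  X₀ : Ω → Eucl k
  X₁ : Ω → Eucl k
  measurable_Y₀ : Measurable Y₀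
  measurable_Y₁ : Measurable Y₁
  measurable_V : Measurable V
  measurable_Z : Measurable Z
  measurable_Γ : Measurable Γ
  measurable_Θ : Measurable Θ
  measurable_X₀ : Measurable X₀
  measurable_X₁ : Measurable X₁

namespace TreatmentModel

variable {Ω : Type*} [MeasurableSpace Ω] {m k : ℕ} (M : TreatmentModel Ω m k)

instance : IsProbabilityMeasure M.P := M.isProb

/-- The gain from treatment. -/
def Δ (ω : Ω) : ℝ := M.Y₁ ω - M.Y₀ ω

open Classical in
/-- Treatment status, `D = 1{V - Z'Γ - Θ > 0}`. -/
def D (ω : Ω) : ℝ := if 0 < M.V ω - inner ℝ (M.Z ω) (M.Γ ω) - M.Θ ω then 1 else 0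

/-- Observed outcome, `Y = Y₀ + Δ D`. -/
def Y (ω : Ω) : ℝ := M.Y₀ ω + M.Δ ω * M.D ω

open Classical in
/-- Observed covariate: `X₁` for the treated and `X₀` for the untreated. -/
def X (ω : Ω) : Eucl k := if M.D ω = 1 then M.X₁ ω else M.X₀ ω

/-- `S̃ = (Z, 1) / ‖(Z, 1)‖`. -/
def S (ω : Ω) : Eucl (m + 1) := ‖appendCoord (M.Z ω) 1‖⁻¹ • appendCoord (M.Z ω) 1

/-- `Ṽ = V / ‖(Z, 1)‖`. -/
def Vt (ω : Ω) : ℝ := M.V ω / ‖appendCoord (M.Z ω) 1‖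

/-- `Γ̃ = (Γ, Θ)`. -/
def Γt (ω : Ω) : Eucl (m + 1) := appendCoord (M.Γ ω) (M.Θ ω)

/-- The law of `X`. -/
def lawX : Measure (Eucl k) := M.P.map M.X

/-- The conditional law of `W` given `X = x`. -/
def condLaw {β : Type*} [MeasurableSpace β] [StandardBorelSpace β] [Nonempty β]
    (W : Ω → β) (x : Eucl k) : Measure β :=
  condDistrib W M.X M.P x

/-- The conditional Lebesgue density `f_{W|X}(· | x)`. -/
def condDensity {β : Type*} [MeasureSpace β] [StandardBorelSpace β] [Nonempty β]
    (W : Ω → β) (x : Eucl k) (w : β) : ℝ :=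
  ((M.condLaw W x).rnDeriv volume w).toReal

/-- The conditional mean `E[W | T = t]`, through the regular conditional distribution of `W`
given `T`. -/
def condMean {τ : Type*} [MeasurableSpace τ] (W : Ω → ℝ) (T : Ω → τ) (t : τ) : ℝ :=
  ∫ w, w ∂(condDistrib W T M.P t)

/-- `r` is a version of the regression function `E[W | T = ·]`. -/
def IsRegression {τ : Type*} [MeasurableSpace τ] (W : Ω → ℝ) (T : Ω → τ) (r : τ → ℝ) : Prop :=
  Measurable r ∧ ∀ᵐ t ∂(M.P.map T), r t = M.condMean W T t

/-! ### Assumptions -/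

/-- Absolute continuity of the conditional law of `(S̃, Ṽ, Γ, Θ)` given `X`; conditional
independence of the instruments and the unobservables given `X`; non-degenerate propensity score;
covariates not caused by the treatment. -/
structure BaseAssumptions : Prop where
  absCont : ∀ᵐ x ∂M.lawX,
    M.condLaw (fun ω => (M.S ω, M.Vt ω, M.Γt ω)) x ≪
      (sphereMeasure m).prod ((volume : Measure ℝ).prod (volume : Measure (Eucl (m + 1))))
  indep₀ : ∀ᵐ x ∂M.lawX, IndepFun Prod.fst Prod.snd
    (M.condLaw (fun ω => ((M.V ω, M.Z ω), (M.Y₀ ω, M.Γ ω, M.Θ ω))) x)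
  indep₁ : ∀ᵐ x ∂M.lawX, IndepFun Prod.fst Prod.snd
    (M.condLaw (fun ω => ((M.V ω, M.Z ω), (M.Y₁ ω, M.Γ ω, M.Θ ω))) x)
  score : ∀ᵐ x ∂M.lawX, 0 < M.condLaw M.D x {1} ∧ M.condLaw M.D x {1} < 1
  covariates : M.X₀ =ᵐ[M.P] M.X₁

/-- `E[|Y₁| + |Y₀|] < ∞`. -/
def FirstMoments : Prop := Integrable (fun ω => |M.Y₁ ω| + |M.Y₀ ω|) M.P

/-- Large support for `L = 1`: the conditional support of `V` contains that of `Θ`. -/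
def LargeSupportOne : Prop :=
  ∀ᵐ x ∂M.lawX, (M.condLaw M.Θ x).support ⊆ (M.condLaw M.V x).support

/-- The real numbers between `inf s'γ` and `sup s'γ`, where `γ` runs through the support of the
conditional law of `Γ̃` given `X = x` (the bounds may be infinite). -/
def indexRange (s : Eucl (m + 1)) (x : Eucl k) : Set ℝ :=
  {v | (⨅ γ ∈ (M.condLaw M.Γt x).support, ((inner ℝ s γ : ℝ) : EReal)) ≤ (v : EReal) ∧
    (v : EReal) ≤ ⨆ γ ∈ (M.condLaw M.Γt x).support, ((inner ℝ s γ : ℝ) : EReal)}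

/-- Large support for `L ≥ 2`: given `X = x`, the support of `S̃` is the closed hemisphere, and
given `S̃ = s` and `X = x` the support of `Ṽ` contains `[inf s'γ, sup s'γ]`. -/
def LargeSupport : Prop :=
  ∀ᵐ x ∂M.lawX, (M.condLaw M.S x).support = closure (hemisphere m) ∧
    ∀ᵐ s ∂(M.condLaw M.S x),
      M.indexRange s x ⊆ (condDistrib M.Vt (fun ω => (M.S ω, M.X ω)) M.P (s, x)).support

/-! ### The scalar case `L = 1` -/

/-- `UCATE(θ, x) = E[Δ | Θ = θ, X = x]`. -/
def ucateOne (θ : ℝ) (x : Eucl k) : ℝ :=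
  M.condMean M.Δ (fun ω => (M.Θ ω, M.X ω)) (θ, x)

/-- `UCATE(·, x)` extended by `0` outside the support of `Θ` given `X = x`, times
`f_{Θ|X}(· | x)`. -/
def ucateDensityOne (x : Eucl k) (θ : ℝ) : ℝ :=
  (M.condLaw M.Θ x).support.indicator (fun t => M.ucateOne t x) θ * M.condDensity M.Θ x θ

/-- A version `r (v, x)` of `E[Y | V = v, X = x]` that is continuous in `v` on the support of `V`
given `X = x`. Two such versions agree on that support, for almost every `x`. -/
def IsOutcomeRegressionOne (r : ℝ × Eucl k → ℝ) : Prop :=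
  M.IsRegression M.Y (fun ω => (M.V ω, M.X ω)) r ∧
    ∀ᵐ x ∂M.lawX, ContinuousOn (fun v => r (v, x)) (M.condLaw M.V x).support

/-- `∂_v r(·, x)` on the support of `V` given `X = x`, extended by `0`. -/
def dvOne (r : ℝ × Eucl k → ℝ) (x : Eucl k) : ℝ → ℝ :=
  (M.condLaw M.V x).support.indicator
    (derivWithin (fun v => r (v, x)) (M.condLaw M.V x).support)

/-! ### The multivariate case `L ≥ 2` -/

/-- `UCATE(γ, x) = E[Δ | Γ̃ = γ, X = x]`. -/
def ucate (γ : Eucl (m + 1)) (x : Eucl k) : ℝ :=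
  M.condMean M.Δ (fun ω => (M.Γt ω, M.X ω)) (γ, x)

/-- `UCATE(·, x)` extended by `0` outside the support of `Γ̃` given `X = x`, times
`f_{Γ̃|X}(· | x)`. -/
def ucateDensity (x : Eucl k) (γ : Eucl (m + 1)) : ℝ :=
  (M.condLaw M.Γt x).support.indicator (fun g => M.ucate g x) γ * M.condDensity M.Γt x γ

/-- The support of `(S̃, Ṽ)` given `X = x`. -/
def instrSupport (x : Eucl k) : Set (Eucl (m + 1) × ℝ) :=
  (M.condLaw (fun ω => (M.S ω, M.Vt ω)) x).support

/-- The section of the support of `(S̃, Ṽ)` given `X = x` at `S̃ = s`. -/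
def instrSection (s : Eucl (m + 1)) (x : Eucl k) : Set ℝ :=
  {v | (s, v) ∈ M.instrSupport x}

/-- A version `r (s, v, x)` of `E[Y | S̃ = s, Ṽ = v, X = x]` that is continuous in `(s, v)` on the
support of `(S̃, Ṽ)` given `X = x`. Two such versions agree on that support, for almost every
`x`. -/
def IsOutcomeRegression (r : Eucl (m + 1) × ℝ × Eucl k → ℝ) : Prop :=
  M.IsRegression M.Y (fun ω => (M.S ω, M.Vt ω, M.X ω)) r ∧
    ∀ᵐ x ∂M.lawX, ContinuousOn
      (fun q : Eucl (m + 1) × ℝ => r (q.1, q.2, x)) (M.instrSupport x)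

/-- `∂_v r(s, ·, x)` on the support of `(S̃, Ṽ)` given `X = x`, extended by `0`. -/
def dv (r : Eucl (m + 1) × ℝ × Eucl k → ℝ) (x : Eucl k) (s : Eucl (m + 1)) : ℝ → ℝ :=
  (M.instrSection s x).indicator
    (derivWithin (fun v => r (s, v, x)) (M.instrSection s x))

/-! ### Observational equivalence -/

/-- The law of the observables `(Y, D, V, Z, X)`. -/
def lawObs : Measure (ℝ × ℝ × ℝ × Eucl m × Eucl k) :=
  M.P.map (fun ω => (M.Y ω, M.D ω, M.V ω, M.Z ω, M.X ω))

end TreatmentModel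

end

/-! The regression of the observed outcome on the instruments is a primitive of the effect.

Fix a covariate value `x`. Given `X = x` the instruments are independent of the unobservables, so
the regression of `Y` at instrument value `t` is the mean of `Y₀` off the selection event plus the
mean of `Y₁` on it, both computed with the instruments frozen at `t`. Hence it is a constant plus the
integral, over the set of coefficients selected at `t`, of the density weighted effect
`h = UCATE · f` (`exists_regression_eq_add_setIntegral`; this rests on the kernel form of
conditional independence, on the chain rule for regular conditional distributions and on
Radon-Nikodym). This explicit version is continuous in `t`, and continuous versions agree on the
support of the instruments (`ae_eqOn_support_of_ae_eq`).

* For one instrument the selected set is `{θ < v}`, and Lebesgue differentiation along the support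
  of `V` returns `h` (`ae_derivWithin_eq_of_eqOn_integral_Iio`). Isolated points of the support,
  where a derivative along it means nothing, are countable.
* For several instruments the selected set is the half space `{⟪s, γ⟫ < v}`. By Fubini the integral
  over it is `∫_{u < v} R h(s, u) du` (`setIntegral_halfSpace_eq_integral_radon`), so the derivative
  in `v` is `R h(s, ·)` on the section of the support at `s`. Large support makes that section
  contain all index values strictly between the extreme ones, for every direction and not only for
  almost every one (`LargeSupport.mem_instrSection`); elsewhere `R h(s, ·)` vanishes up to two
  points. So the derivative extended by `0` is `R h`. The Radon transform in almost all directions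
  of the hemisphere determines an integrable function, by the projection-slice theorem and
  uniqueness of characteristic functions (`IsRadonPreimage.ae_eq`).

Identification: the regression, the supports and hence `h` depend on the law of the observables
only. Applied to the model with outcome `D`, whose effect is `1`, this identifies the density of the
coefficients; dividing `h` by it identifies the effect. -/

/-! ### Regular conditional distributions -/

section Kernels
variable {Ω τ ξ ω E : Type*} [MeasurableSpace Ω] [MeasurableSpace τ] [MeasurableSpace ξ]
  [MeasurableSpace ω] [MeasurableSpace E] {P : Measure Ω} [IsProbabilityMeasure P]

/-- Reordering or recoding the conditioning variable by a measurable equivalence. -/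
theorem condDistrib_measurableEquiv_comp {ξ' : Type*} [MeasurableSpace ξ']
    [StandardBorelSpace ω] [Nonempty ω] {W : Ω → ω} {X : Ω → ξ}
    (hW : Measurable W) (hX : Measurable X) (e : ξ ≃ᵐ ξ') :
    condDistrib W (fun a => e (X a)) P =ᵐ[P.map fun a => e (X a)]
      (condDistrib W X P).comap e.symm e.symm.measurable := by
  have h : HasCondDistrib W X (condDistrib W X P) P :=
    ⟨(hX.prodMk hW).aemeasurable, (compProd_map_condDistrib hW.aemeasurable).symm⟩
  exact condDistrib_ae_eq_of_measure_eq_compProd _ hW.aemeasurable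
    (h.measurableEquiv_comp_right e).map_eq

/-- Images of regular conditional distributions. -/
theorem condDistrib_comp_ae [StandardBorelSpace ω] [Nonempty ω] [StandardBorelSpace E] [Nonempty E]
    {W : Ω → ω} (X : Ω → ξ) (hW : Measurable W) {f : ω → E} (hf : Measurable f) :
    ∀ᵐ x ∂P.map X, condDistrib (fun a => f (W a)) X P x = (condDistrib W X P x).map f := by
  filter_upwards [condDistrib_comp (μ := P) X hW.aemeasurable hf] with x hx
  rw [← Kernel.map_apply _ hf, ← hx]
  rfl

/-- Conditional independence, in kernel form: if `T` and `W` are independent given `X`, then the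
conditional law of `W` given `(T, X)` does not depend on `T`. -/
theorem condDistrib_prodMk_ae_eq_of_indepFun [StandardBorelSpace τ] [Nonempty τ]
    [StandardBorelSpace ω] [Nonempty ω] {T : Ω → τ} {W : Ω → ω} {X : Ω → ξ}
    (hT : Measurable T) (hW : Measurable W) (hX : Measurable X)
    (h : ∀ᵐ x ∂P.map X, IndepFun Prod.fst Prod.snd (condDistrib (fun a => (T a, W a)) X P x)) :
    condDistrib W (fun a => (T a, X a)) P =ᵐ[P.map fun a => (T a, X a)]
      (condDistrib W X P).prodMkLeft τ := by
  have h1 := condDistrib_comp_ae (P := P) X (hT.prodMk hW) measurable_fst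
  have h2 := condDistrib_comp_ae (P := P) X (hT.prodMk hW) measurable_snd
  have key : condDistrib (fun a => (T a, W a)) X P =ᵐ[P.map X]
      (condDistrib T X P) ⊗ₖ ((condDistrib W X P).prodMkRight τ) := by
    filter_upwards [h, h1, h2] with x hx e1 e2
    rw [indepFun_iff_map_prod_eq_prod_map_map measurable_fst.aemeasurable
      measurable_snd.aemeasurable, ← e1, ← e2] at hx
    have hx' : condDistrib (fun a => (T a, W a)) X P x
        = (condDistrib T X P x).prod (condDistrib W X P x) := by
      rw [← hx]; simp
    rw [hx']
    ext s hs
    rw [Measure.prod_apply hs, Kernel.compProd_apply hs]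
    rfl
  have h3 : HasCondDistrib (fun a => (T a, W a)) X
      ((condDistrib T X P) ⊗ₖ ((condDistrib W X P).prodMkRight τ)) P :=
    ⟨by fun_prop, by
      rw [← compProd_map_condDistrib (hT.prodMk hW).aemeasurable]
      exact Measure.compProd_congr key⟩
  have h4 := h3.of_compProd.measurableEquiv_comp_right MeasurableEquiv.prodComm
  exact condDistrib_ae_eq_of_measure_eq_compProd _ hW.aemeasurable h4.map_eq

/-- Chain rule for regular conditional distributions. -/
theorem condDistrib_prodMk_ae_eq_compProd [StandardBorelSpace E] [Nonempty E]
    [StandardBorelSpace ω] [Nonempty ω] {G : Ω → E} {W : Ω → ω} {X : Ω → ξ}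
    (hG : Measurable G) (hW : Measurable W) (hX : Measurable X) :
    condDistrib (fun a => (G a, W a)) X P =ᵐ[P.map X]
      (condDistrib G X P) ⊗ₖ
        ((condDistrib W (fun a => (G a, X a)) P).comap Prod.swap measurable_swap) := by
  refine condDistrib_ae_eq_of_measure_eq_compProd _ (hG.prodMk hW).aemeasurable ?_
  have h1 := condDistrib_measurableEquiv_comp (P := P) hW (hG.prodMk hX) MeasurableEquiv.prodComm
  have h2 : condDistrib W (fun a => (X a, G a)) P =ᵐ[P.map fun a => (X a, G a)]
      (condDistrib W (fun a => (G a, X a)) P).comap Prod.swap measurable_swap := h1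
  rw [← Measure.compProd_assoc', compProd_map_condDistrib hG.aemeasurable,
    ← Measure.compProd_congr h2, compProd_map_condDistrib hW.aemeasurable,
    Measure.map_map (by fun_prop) (by fun_prop)]
  rfl

/-- Regression on `(T, X)` of a function of `T` and of a variable `W` that is independent of `T`
given `X`. -/
theorem condExp_prodMk_ae_eq_of_indepFun [StandardBorelSpace τ] [Nonempty τ]
    [StandardBorelSpace ω] [Nonempty ω] {T : Ω → τ} {W : Ω → ω} {X : Ω → ξ}
    (hT : Measurable T) (hW : Measurable W) (hX : Measurable X)
    (h : ∀ᵐ x ∂P.map X, IndepFun Prod.fst Prod.snd (condDistrib (fun a => (T a, W a)) X P x))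
    {F : τ × ω → ℝ} (hF : Measurable F) (hFi : Integrable (fun a => F (T a, W a)) P) :
    P[fun a => F (T a, W a) | MeasurableSpace.comap (fun a => (T a, X a)) inferInstance] =ᵐ[P]
      fun a => ∫ w, F (T a, w) ∂condDistrib W X P (X a) := by
  have h1 := condExp_prod_ae_eq_integral_condDistrib (μ := P) (hT.prodMk hX) hW.aemeasurable
    (f := fun p : (τ × ξ) × ω => F (p.1.1, p.2))
    (by fun_prop : Measurable fun p : (τ × ξ) × ω => F (p.1.1, p.2)).stronglyMeasurable hFi
  have h2 := ae_of_ae_map (hT.prodMk hX).aemeasurable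
    (condDistrib_prodMk_ae_eq_of_indepFun hT hW hX h)
  filter_upwards [h1, h2] with a ha1 ha2
  rw [ha1, ha2]
  rfl

/-- The regular conditional distribution is a function of the joint law. -/
theorem condDistrib_congr_of_map_eq {Ω' : Type*} [MeasurableSpace Ω'] {P' : Measure Ω'}
    [IsProbabilityMeasure P'] [StandardBorelSpace ω] [Nonempty ω] {W : Ω → ω} {X : Ω → ξ}
    {W' : Ω' → ω} {X' : Ω' → ξ} (hW : Measurable W) (hX : Measurable X) (hW' : Measurable W')
    (hX' : Measurable X') (h : P'.map (fun a => (X' a, W' a)) = P.map (fun a => (X a, W a))) :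
    condDistrib W' X' P' =ᵐ[P.map X] condDistrib W X P := by
  have hX1 : P'.map X' = P.map X := by
    have := congrArg (Measure.map Prod.fst) h
    rwa [Measure.map_map (by fun_prop) (by fun_prop),
      Measure.map_map (by fun_prop) (by fun_prop)] at this
  rw [← hX1]
  refine condDistrib_ae_eq_of_measure_eq_compProd _ hW'.aemeasurable ?_
  rw [h, hX1, compProd_map_condDistrib hW.aemeasurable]

/-- Conditional independence is preserved by measurable maps of the two variables. -/
theorem indepFun_condDistrib_comp {τ' ω' : Type*} [MeasurableSpace τ'] [MeasurableSpace ω']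
    [StandardBorelSpace τ] [Nonempty τ] [StandardBorelSpace ω] [Nonempty ω]
    [StandardBorelSpace τ'] [Nonempty τ'] [StandardBorelSpace ω'] [Nonempty ω']
    {T : Ω → τ} {W : Ω → ω} {X : Ω → ξ} (hT : Measurable T) (hW : Measurable W)
    {f : τ → τ'} {g : ω → ω'} (hf : Measurable f) (hg : Measurable g)
    (h : ∀ᵐ x ∂P.map X, IndepFun Prod.fst Prod.snd (condDistrib (fun a => (T a, W a)) X P x)) :
    ∀ᵐ x ∂P.map X, IndepFun Prod.fst Prod.snd
      (condDistrib (fun a => (f (T a), g (W a))) X P x) := by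
  have h1 := condDistrib_comp_ae (P := P) X (hT.prodMk hW)
    (f := fun p : τ × ω => (f p.1, g p.2)) (by fun_prop)
  filter_upwards [h, h1] with x hx hx1
  rw [hx1, indepFun_iff_measure_inter_preimage_eq_mul]
  intro s t hs ht
  rw [Measure.map_apply (by fun_prop) (by measurability),
    Measure.map_apply (by fun_prop) (measurable_fst hs),
    Measure.map_apply (by fun_prop) (measurable_snd ht)]
  exact (indepFun_iff_measure_inter_preimage_eq_mul.1 hx) _ _ (hf hs) (hg ht)

end Kernels

/-! ### Regressions under conditional independence -/

section Regression
variable {Ω τ ξ E : Type*} [MeasurableSpace Ω] [MeasurableSpace τ] [MeasurableSpace ξ]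
  {P : Measure Ω} [IsProbabilityMeasure P]

/-- The conditional mean of `W` given `(G, X) = (·, x)`, cut off outside the support of `G` given
`X = x`, times the density of `G` given `X = x`. -/
noncomputable def effectDensity [MeasureSpace E] [TopologicalSpace E] [StandardBorelSpace E]
    [Nonempty E]
    (P : Measure Ω) [IsProbabilityMeasure P] (W : Ω → ℝ) (G : Ω → E) (X : Ω → ξ) (x : ξ) (g : E) :
    ℝ :=
  (condDistrib G X P x).support.indicator
      (fun g => ∫ w, w ∂condDistrib W (fun a => (G a, X a)) P (g, x)) g *
    ((condDistrib G X P x).rnDeriv volume g).toReal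

variable [MeasureSpace E] [TopologicalSpace E] [StandardBorelSpace E] [Nonempty E]
    [HereditarilyLindelofSpace E] [SigmaFinite (volume : Measure E)]

/-- The cut-off at the support is immaterial almost everywhere. -/
theorem effectDensity_ae_eq (W : Ω → ℝ) (G : Ω → E) (X : Ω → ξ) (x : ξ) :
    effectDensity P W G X x =ᵐ[volume] fun g => ((condDistrib G X P x).rnDeriv volume g).toReal •
      ∫ w, w ∂condDistrib W (fun a => (G a, X a)) P (g, x) := by
  filter_upwards [Measure.ae_rnDeriv_ne_zero_imp_of_ae (μ := condDistrib G X P x) volume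
    Measure.support_mem_ae] with g hg
  by_cases h0 : (condDistrib G X P x).rnDeriv volume g = 0
  · simp [effectDensity, h0]
  · rw [effectDensity, indicator_of_mem (hg h0), smul_eq_mul, mul_comm]

/-- Integrals of `effectDensity` over a set are conditional means of `W` on the event that `G` lies
in that set. -/
theorem setIntegral_effectDensity {W : Ω → ℝ} {G : Ω → E} {X : Ω → ξ}
    (hW : Measurable W) (hG : Measurable G) (hX : Measurable X) (hWi : Integrable W P)
    (hac : ∀ᵐ x ∂P.map X, condDistrib G X P x ≪ volume) :
    ∀ᵐ x ∂P.map X, Integrable (effectDensity P W G X x) ∧ ∀ B : Set E, MeasurableSet B →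
      ∫ g in B, effectDensity P W G X x g =
        ∫ p in B ×ˢ univ, p.2 ∂condDistrib (fun a => (G a, W a)) X P x := by
  have hi : Integrable (fun q : ξ × E × ℝ => q.2.2) (P.map fun a => (X a, (G a, W a))) := by
    rw [integrable_map_measure (Measurable.aestronglyMeasurable (by fun_prop)) (by fun_prop)]
    exact hWi
  filter_upwards [hac, condDistrib_prodMk_ae_eq_compProd hG hW hX,
    hi.condDistrib_ae_map (hG.prodMk hW).aemeasurable] with x hx hc hxi
  rw [hc] at hxi
  have h1 := hxi.integral_compProd
  simp only [Kernel.comap_apply, Prod.swap_prod_mk] at h1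
  refine ⟨(integrable_congr (effectDensity_ae_eq W G X x)).2
    ((integrable_rnDeriv_smul_iff hx).2 h1), fun B hB => ?_⟩
  rw [setIntegral_congr_ae hB ((effectDensity_ae_eq W G X x).mono fun g hg _ => hg),
    setIntegral_rnDeriv_smul hx hB, hc, setIntegral_compProd hB MeasurableSet.univ
    hxi.integrableOn]
  simp

/-- If the instruments `T` are independent of `(Y₀, G)` and of `(Y₁, G)` given `X`, the regression
on `(T, X)` of an outcome that equals `Y₁` on the event `(T, G) ∈ A` and `Y₀` off it has a
version `r` such that `r (t, x)` is, up to a constant depending on `x`, the integral of the density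
weighted effect over the section of `A` at `t`. -/
theorem exists_regression_eq_add_setIntegral [StandardBorelSpace τ] [Nonempty τ]
    {Y₀ Y₁ Y : Ω → ℝ} {T : Ω → τ} {G : Ω → E} {X : Ω → ξ} {A : Set (τ × E)}
    (hA : MeasurableSet A)
    (hY₀ : Measurable Y₀) (hY₁ : Measurable Y₁) (hT : Measurable T) (hG : Measurable G)
    (hX : Measurable X) (hi₀ : Integrable Y₀ P) (hi₁ : Integrable Y₁ P)
    (hYA : ∀ a, (T a, G a) ∈ A → Y a = Y₁ a) (hYA' : ∀ a, (T a, G a) ∉ A → Y a = Y₀ a)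
    (hac : ∀ᵐ x ∂P.map X, condDistrib G X P x ≪ volume)
    (h₀ : ∀ᵐ x ∂P.map X, IndepFun Prod.fst Prod.snd
      (condDistrib (fun a => (T a, (Y₀ a, G a))) X P x))
    (h₁ : ∀ᵐ x ∂P.map X, IndepFun Prod.fst Prod.snd
      (condDistrib (fun a => (T a, (Y₁ a, G a))) X P x)) :
    ∃ r : τ × ξ → ℝ, Measurable r ∧
      (fun a => r (T a, X a)) =ᵐ[P]
        P[Y | MeasurableSpace.comap (fun a => (T a, X a)) inferInstance] ∧
      ∀ᵐ x ∂P.map X, Integrable (effectDensity P (fun a => Y₁ a - Y₀ a) G X x) ∧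
        ∃ c, ∀ t, r (t, x) =
          c + ∫ g in {g | (t, g) ∈ A}, effectDensity P (fun a => Y₁ a - Y₀ a) G X x g := by
  have hB : MeasurableSet {q : τ × ℝ × E | (q.1, q.2.2) ∈ A} :=
    hA.preimage (f := fun q : τ × ℝ × E => (q.1, q.2.2)) (by fun_prop)
  set F₀ : τ × ℝ × E → ℝ := indicator {q | (q.1, q.2.2) ∈ A}ᶜ (fun q => q.2.1) with hF₀
  set F₁ : τ × ℝ × E → ℝ := indicator {q | (q.1, q.2.2) ∈ A} (fun q => q.2.1) with hF₁
  have mY : Measurable fun q : τ × ℝ × E => q.2.1 := by fun_prop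
  have mF₀ : Measurable F₀ := mY.indicator hB.compl
  have mF₁ : Measurable F₁ := mY.indicator hB
  have mTG : MeasurableSet {a | (T a, G a) ∈ A} := (hT.prodMk hG) hA
  have e₀ : (fun a => F₀ (T a, (Y₀ a, G a))) = indicator {a | (T a, G a) ∈ A}ᶜ Y₀ := by
    ext a; by_cases ha : (T a, G a) ∈ A <;> simp [hF₀, ha]
  have e₁ : (fun a => F₁ (T a, (Y₁ a, G a))) = indicator {a | (T a, G a) ∈ A} Y₁ := by
    ext a; by_cases ha : (T a, G a) ∈ A <;> simp [hF₁, ha]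
  have i₀ : Integrable (fun a => F₀ (T a, (Y₀ a, G a))) P := by
    rw [e₀]; exact hi₀.indicator mTG.compl
  have i₁ : Integrable (fun a => F₁ (T a, (Y₁ a, G a))) P := by
    rw [e₁]; exact hi₁.indicator mTG
  have hY : Y = (fun a => F₀ (T a, (Y₀ a, G a))) + fun a => F₁ (T a, (Y₁ a, G a)) := by
    ext a
    rw [e₀, e₁]
    by_cases ha : (T a, G a) ∈ A
    · simp [indicator, ha, hYA a ha]
    · simp [indicator, ha, hYA' a ha]
  have c₀ := condExp_prodMk_ae_eq_of_indepFun hT (hY₀.prodMk hG) hX h₀ mF₀ i₀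
  have c₁ := condExp_prodMk_ae_eq_of_indepFun hT (hY₁.prodMk hG) hX h₁ mF₁ i₁
  have meas : ∀ (κ : Kernel ξ (ℝ × E)) [IsSFiniteKernel κ] (F : τ × ℝ × E → ℝ), Measurable F →
      Measurable fun p : τ × ξ => ∫ w, F (p.1, w) ∂κ p.2 := by
    intro κ _ F hF
    exact (StronglyMeasurable.integral_kernel_prod_right' (κ := κ.prodMkLeft τ)
      (f := fun q : (τ × ξ) × ℝ × E => F (q.1.1, q.2))
      (by fun_prop : Measurable _).stronglyMeasurable).measurable
  refine ⟨fun p => ∫ w, F₀ (p.1, w) ∂condDistrib (fun a => (Y₀ a, G a)) X P p.2 +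
      ∫ w, F₁ (p.1, w) ∂condDistrib (fun a => (Y₁ a, G a)) X P p.2,
    (meas _ _ mF₀).add (meas _ _ mF₁), ?_, ?_⟩
  · rw [hY]
    filter_upwards [c₀, c₁, condExp_add i₀ i₁
      (MeasurableSpace.comap (fun a => (T a, X a)) inferInstance)] with a h0 h1 h2
    rw [h2, Pi.add_apply, h0, h1]
  -- the two potential outcomes and `G` have a joint conditional law, of which the laws of
  -- `(Y₀, G)`, `(Y₁, G)` and `(G, Y₁ - Y₀)` are images
  · have mJ : Measurable fun a => (Y₀ a, Y₁ a, G a) := by fun_prop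
    have k₀ := condDistrib_comp_ae (P := P) X mJ (f := fun q : ℝ × ℝ × E => (q.1, q.2.2))
      (by fun_prop)
    have k₁ := condDistrib_comp_ae (P := P) X mJ (f := fun q : ℝ × ℝ × E => (q.2.1, q.2.2))
      (by fun_prop)
    have kΔ := condDistrib_comp_ae (P := P) X mJ
      (f := fun q : ℝ × ℝ × E => (q.2.2, q.2.1 - q.1)) (by fun_prop)
    have j₀ : Integrable (fun q : ξ × ℝ × ℝ × E => q.2.1)
        (P.map fun a => (X a, (Y₀ a, Y₁ a, G a))) := by
      rw [integrable_map_measure (Measurable.aestronglyMeasurable (by fun_prop)) (by fun_prop)]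
      exact hi₀
    have j₁ : Integrable (fun q : ξ × ℝ × ℝ × E => q.2.2.1)
        (P.map fun a => (X a, (Y₀ a, Y₁ a, G a))) := by
      rw [integrable_map_measure (Measurable.aestronglyMeasurable (by fun_prop)) (by fun_prop)]
      exact hi₁
    filter_upwards [k₀, k₁, kΔ, j₀.condDistrib_ae_map mJ.aemeasurable,
      j₁.condDistrib_ae_map mJ.aemeasurable, setIntegral_effectDensity (W := fun a => Y₁ a - Y₀ a)
        (hY₁.sub hY₀) hG hX (hi₁.sub hi₀) hac] with x q₀ q₁ qΔ l₀ l₁ hx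
    refine ⟨hx.1, ∫ q, q.1 ∂condDistrib (fun a => (Y₀ a, Y₁ a, G a)) X P x, fun t => ?_⟩
    have mAt : MeasurableSet {g | (t, g) ∈ A} := measurable_prodMk_left hA
    have mC : MeasurableSet {q : ℝ × ℝ × E | (t, q.2.2) ∈ A} :=
      mAt.preimage (f := fun q : ℝ × ℝ × E => q.2.2) (by fun_prop)
    rw [hx.2 _ mAt]
    simp only [q₀, q₁]
    have m₀ : Measurable fun w => F₀ (t, w) := mF₀.comp measurable_prodMk_left
    have m₁ : Measurable fun w => F₁ (t, w) := mF₁.comp measurable_prodMk_left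
    rw [qΔ, integral_map (by fun_prop) m₀.aestronglyMeasurable,
      integral_map (by fun_prop) m₁.aestronglyMeasurable,
      setIntegral_map (mAt.prod MeasurableSet.univ) (by fun_prop) (by fun_prop)]
    have p₀ : (fun q : ℝ × ℝ × E => F₀ (t, (q.1, q.2.2))) =
        indicator {q | (t, q.2.2) ∈ A}ᶜ fun q => q.1 := by
      ext q; by_cases hq : (t, q.2.2) ∈ A <;> simp [hF₀, hq]
    have p₁ : (fun q : ℝ × ℝ × E => F₁ (t, (q.2.1, q.2.2))) =
        indicator {q | (t, q.2.2) ∈ A} fun q => q.2.1 := by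
      ext q; by_cases hq : (t, q.2.2) ∈ A <;> simp [hF₁, hq]
    have pΔ : (fun q : ℝ × ℝ × E => (q.2.2, q.2.1 - q.1)) ⁻¹' ({g | (t, g) ∈ A} ×ˢ univ) =
        {q | (t, q.2.2) ∈ A} := by
      ext q; simp
    rw [p₀, p₁, pΔ, integral_indicator mC.compl, integral_indicator mC,
      ← integral_add_compl mC l₀, integral_sub l₁.integrableOn l₀.integrableOn]
    ring

end Regression

/-! ### Functions continuous on the support of a measure -/

section Support

/-- Two functions that are continuous on the support of a measure and equal almost everywhere agree
on the whole support. -/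
theorem eqOn_support_of_ae_eq {α β : Type*} [TopologicalSpace α] [MeasurableSpace α]
    [HereditarilyLindelofSpace α] [TopologicalSpace β] [T2Space β] {μ : Measure α} {f g : α → β}
    (hf : ContinuousOn f μ.support) (hg : ContinuousOn g μ.support) (h : f =ᵐ[μ] g) :
    EqOn f g μ.support := by
  intro p hp
  have hne : (nhdsWithin p (μ.support ∩ {q | f q = g q})).NeBot := by
    rw [← mem_closure_iff_nhdsWithin_neBot, mem_closure_iff_nhds]
    intro U hU
    have hpos := (Measure.mem_support_iff_forall p).1 hp U hU
    have h0 : μ (μ.support ∩ {q | f q = g q})ᶜ = 0 :=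
      (Filter.inter_mem Measure.support_mem_ae h : μ.support ∩ {q | f q = g q} ∈ ae μ)
    by_contra hcon
    rw [Set.not_nonempty_iff_eq_empty] at hcon
    refine hpos.ne' (measure_mono_null (fun q hq => ?_) h0)
    intro hq'
    exact (hcon ▸ (⟨hq, hq'⟩ : q ∈ U ∩ _) : q ∈ (∅ : Set α))
  have hmono := nhdsWithin_mono p (inter_subset_left (s := μ.support) (t := {q | f q = g q}))
  refine tendsto_nhds_unique ((hf p hp).tendsto.mono_left hmono) ?_
  refine ((hg p hp).tendsto.mono_left hmono).congr' ?_
  filter_upwards [self_mem_nhdsWithin] with q hq using hq.2.symm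

end Support

/-! ### Lebesgue differentiation along a subset of the line -/

section RealLine

theorem add_integral_Iio_eq {H : ℝ → ℝ} (hH : Integrable H) (c : ℝ) :
    (fun v => c + ∫ u in Iio v, H u) =
      fun v => (c + ∫ u in Iic 0, H u) + ∫ u in (0 : ℝ)..v, H u := by
  ext w
  rw [← integral_Iic_eq_integral_Iio,
    ← intervalIntegral.integral_Iic_sub_Iic hH.integrableOn hH.integrableOn]
  ring

/-- Lebesgue differentiation along a subset `S` of the line. Almost every point of `S` is an
accumulation point of `S`, since the isolated points are countable; so the derivative is unique. -/
theorem ae_derivWithin_eq_of_eqOn_integral_Iio {H f : ℝ → ℝ} (hH : Integrable H) {S : Set ℝ}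
    {c : ℝ} (hf : ∀ v ∈ S, f v = c + ∫ u in Iio v, H u) :
    ∀ᵐ v : ℝ, v ∈ S → DifferentiableWithinAt ℝ f S v ∧ derivWithin f S v = H v := by
  have hcount : ∀ᵐ v : ℝ, v ∉ {x | x ∈ S ∧ nhdsWithin x (S ∩ Ioi x) = ⊥} :=
    measure_eq_zero_iff_ae_notMem.1 (countable_setOfPred_isolated_right_within.measure_zero _)
  filter_upwards [LocallyIntegrable.ae_hasDerivAt_integral hH.locallyIntegrable, hcount]
    with v hv hvS hmem
  have hd : HasDerivWithinAt f (H v) S v :=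
    (add_integral_Iio_eq hH c ▸ (hv 0).const_add _ :
      HasDerivAt (fun v => c + ∫ u in Iio v, H u) (H v) v)
      |>.hasDerivWithinAt.congr hf (hf v hmem)
  have hne : (nhdsWithin v (S ∩ Ioi v)).NeBot := ⟨fun h => hvS ⟨hmem, h⟩⟩
  have huniq : UniqueDiffWithinAt ℝ S v := by
    rw [uniqueDiffWithinAt_iff_accPt, accPt_principal_iff_nhdsWithin]
    exact hne.mono (nhdsWithin_mono v fun y hy => ⟨hy.1, (ne_of_gt hy.2 : y ≠ v)⟩)
  exact ⟨hd.differentiableWithinAt, hd.derivWithin huniq⟩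

theorem continuous_add_integral_Iio {H : ℝ → ℝ} (hH : Integrable H) (c : ℝ) :
    Continuous fun v => c + ∫ u in Iio v, H u := by
  rw [add_integral_Iio_eq hH]
  exact continuous_const.add
    (intervalIntegral.continuous_primitive (fun a b => hH.intervalIntegrable) 0)

end RealLine

/-! ### The Radon transform -/

section Radon
variable {m : ℕ}

/-- Splitting of Lebesgue measure along a unit vector `s` and its orthogonal complement. -/
theorem measurePreserving_smul_add_orthogonal {s : Eucl (m + 1)} (hs : ‖s‖ = 1) :
    MeasurePreserving (fun p : ℝ × (Submodule.span ℝ {s})ᗮ => p.1 • s + (p.2 : Eucl (m + 1)))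
      (volume.prod volume) volume := by
  have h1 := (LinearIsometryEquiv.toSpanUnitSingleton (𝕜 := ℝ) s hs).measurePreserving
  have h2 := h1.prod (MeasurePreserving.id (volume : Measure (Submodule.span ℝ {s})ᗮ))
  have h3 := (WithLp.volume_preserving_toLp (Submodule.span ℝ {s})
    (Submodule.span ℝ {s})ᗮ).comp h2
  have h4 := (Submodule.span ℝ {s}).orthogonalDecomposition.symm.measurePreserving.comp h3
  have he : (fun p : ℝ × (Submodule.span ℝ {s})ᗮ => p.1 • s + (p.2 : Eucl (m + 1))) =
      (Submodule.span ℝ {s}).orthogonalDecomposition.symm ∘ WithLp.toLp 2 ∘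
        Prod.map (LinearIsometryEquiv.toSpanUnitSingleton (𝕜 := ℝ) s hs) id := by
    funext p
    simp only [Function.comp_apply, Submodule.orthogonalDecomposition_symm_apply]
    rfl
  rw [he]
  exact h4

theorem inner_smul_add_orthogonal {s : Eucl (m + 1)} (hs : ‖s‖ = 1) (u : ℝ)
    (w : (Submodule.span ℝ {s})ᗮ) : inner ℝ s (u • s + (w : Eucl (m + 1))) = u := by
  have hw : inner ℝ s (w : Eucl (m + 1)) = 0 :=
    (Submodule.mem_orthogonal _ _).1 w.2 s (Submodule.mem_span_singleton_self s)
  rw [inner_add_right, inner_smul_right, hw, real_inner_self_eq_norm_sq, hs]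
  simp

theorem integrable_radon {f : Eucl (m + 1) → ℝ} (hf : Integrable f) {s : Eucl (m + 1)}
    (hs : ‖s‖ = 1) : Integrable (radon f s) :=
  (((measurePreserving_smul_add_orthogonal hs).integrable_comp hf.aestronglyMeasurable).2
    hf).integral_prod_left

/-- Integration over the hyperplanes orthogonal to `s`. -/
theorem integral_smul_inner_eq_integral_radon {F : Type*} [NormedAddCommGroup F] [NormedSpace ℝ F]
    [CompleteSpace F]
    {f : Eucl (m + 1) → ℝ} {s : Eucl (m + 1)} (hs : ‖s‖ = 1) (φ : ℝ → F)
    (hfφ : Integrable fun g => f g • φ (inner ℝ s g)) :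
    ∫ g, f g • φ (inner ℝ s g) = ∫ u, radon f s u • φ u := by
  have hmp := measurePreserving_smul_add_orthogonal hs
  have h1 := (hmp.integrable_comp hfφ.aestronglyMeasurable).2 hfφ
  have h2 := integral_map hmp.measurable.aemeasurable (hmp.map_eq.symm ▸ hfφ.aestronglyMeasurable)
  rw [hmp.map_eq] at h2
  rw [h2]
  refine (integral_prod _ h1).trans (integral_congr_ae (.of_forall fun u => ?_))
  simp only [Function.comp_apply, inner_smul_add_orthogonal hs]
  rw [integral_smul_const]
  rfl

theorem setIntegral_halfSpace_eq_integral_radon {f : Eucl (m + 1) → ℝ} (hf : Integrable f)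
    {s : Eucl (m + 1)} (hs : ‖s‖ = 1) (v : ℝ) :
    ∫ g in {g | inner ℝ s g < v}, f g = ∫ u in Iio v, radon f s u := by
  have hm : MeasurableSet {g : Eucl (m + 1) | inner ℝ s g < v} :=
    measurableSet_lt (by fun_prop) measurable_const
  have he : (fun g => f g • (Iio v).indicator (1 : ℝ → ℝ) (inner ℝ s g)) =
      indicator {g | inner ℝ s g < v} f := by
    ext g; by_cases hg : inner ℝ s g < v <;> simp [hg]
  have h := integral_smul_inner_eq_integral_radon hs ((Iio v).indicator (1 : ℝ → ℝ))
    (f := f) (he ▸ hf.indicator hm)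
  rw [he, integral_indicator hm] at h
  rw [h, ← integral_indicator measurableSet_Iio]
  congr 1
  ext u; by_cases hu : u < v <;> simp [hu]

theorem volume_hyperplane {s : Eucl (m + 1)} (hs : ‖s‖ = 1) (v : ℝ) :
    volume {g : Eucl (m + 1) | inner ℝ s g = v} = 0 := by
  have hm : MeasurableSet {g : Eucl (m + 1) | inner ℝ s g = v} :=
    measurableSet_eq_fun (by fun_prop) measurable_const
  rw [← (measurePreserving_smul_add_orthogonal hs).measure_preimage hm.nullMeasurableSet]
  have : (fun p : ℝ × (Submodule.span ℝ {s})ᗮ => p.1 • s + (p.2 : Eucl (m + 1))) ⁻¹'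
      {g | inner ℝ s g = v} = {v} ×ˢ univ := by
    ext p; simp [inner_smul_add_orthogonal hs]
  rw [this, Measure.prod_prod]
  simp

/-- The integral over a half space depends continuously on the half space. -/
theorem continuousAt_setIntegral_halfSpace {f : Eucl (m + 1) → ℝ} (hf : Integrable f)
    {q : Eucl (m + 1) × ℝ} (hq : ‖q.1‖ = 1) :
    ContinuousAt (fun q : Eucl (m + 1) × ℝ => ∫ g in {g | inner ℝ q.1 g < q.2}, f g) q := by
  have hm : ∀ p : Eucl (m + 1) × ℝ, MeasurableSet {g : Eucl (m + 1) | inner ℝ p.1 g < p.2} :=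
    fun p => measurableSet_lt (by fun_prop) measurable_const
  simp_rw [fun p : Eucl (m + 1) × ℝ => (integral_indicator (μ := volume) (f := f) (hm p)).symm]
  refine tendsto_integral_filter_of_dominated_convergence (fun g => ‖f g‖)
    (.of_forall fun p => (hf.indicator (hm p)).aestronglyMeasurable)
    (.of_forall fun p => .of_forall fun g => norm_indicator_le_norm_self _ _) hf.norm ?_
  filter_upwards [measure_eq_zero_iff_ae_notMem.1 (volume_hyperplane hq q.2)] with g hg
  have hc : Continuous fun p : Eucl (m + 1) × ℝ => inner ℝ p.1 g := by fun_prop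
  refine tendsto_const_nhds.congr' ?_
  rcases lt_or_gt_of_ne (hg : inner ℝ q.1 g ≠ q.2) with h | h
  · filter_upwards [hc.continuousAt.eventually_lt continuousAt_snd h] with p hp
    simp [indicator, h, hp]
  · filter_upwards [continuousAt_snd.eventually_lt hc.continuousAt h] with p hp
    simp [indicator, not_lt.2 h.le, not_lt.2 (le_of_lt hp)]

theorem measurableSet_hemisphere : MeasurableSet (hemisphere m) :=
  (measurableSet_eq_fun measurable_norm measurable_const).inter
    (measurableSet_lt measurable_const
      (by fun_prop : Measurable fun s : Eucl (m + 1) => s (Fin.last m)))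

theorem ae_norm_eq_one_sphereMeasure : ∀ᵐ s ∂sphereMeasure m, ‖s‖ = 1 := by
  rw [sphereMeasure, ae_map_iff (by fun_prop)
    (measurableSet_eq_fun (by fun_prop) measurable_const)]
  exact .of_forall fun s => by simp

theorem sphereMeasure_pos_of_isOpen {W : Set (Eucl (m + 1))} (hW : IsOpen W) {s : Eucl (m + 1)}
    (hs : ‖s‖ = 1) (hsW : s ∈ W) : 0 < sphereMeasure m W := by
  rw [sphereMeasure, Measure.map_apply (by fun_prop) hW.measurableSet,
    Measure.toSphere_apply' _ (hW.measurableSet.preimage (by fun_prop))]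
  -- the cone over `W` inside the open ball contains a nonempty open set
  set O : Set (Eucl (m + 1)) :=
    {y | y ≠ 0} ∩ (fun y => ‖y‖⁻¹ • y) ⁻¹' W ∩ Metric.ball 0 1 with hO
  have hOo : IsOpen O := by
    refine IsOpen.inter ?_ Metric.isOpen_ball
    refine ContinuousOn.isOpen_inter_preimage ?_ isOpen_ne hW
    exact (continuousOn_id.norm.inv₀ fun y hy => norm_ne_zero_iff.2 hy).smul continuousOn_id
  have hOne : O.Nonempty := by
    refine ⟨(1 / 2 : ℝ) • s, ⟨?_, ?_⟩, ?_⟩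
    · have : s ≠ 0 := by rintro rfl; simp at hs
      simp [this]
    · simpa [norm_smul, hs, smul_smul] using hsW
    · simp [norm_smul, hs]; norm_num
  refine ENNReal.mul_pos (by simp) ((hOo.measure_pos volume hOne).trans_le (measure_mono ?_)).ne'
  · rintro y ⟨⟨hy0, hyW⟩, hy1⟩
    have hpos : 0 < ‖y‖ := norm_pos_iff.2 hy0
    refine Set.mem_smul.2 ⟨‖y‖, ⟨hpos, by simpa using hy1⟩, ‖y‖⁻¹ • y, ?_, ?_⟩
    · exact ⟨⟨‖y‖⁻¹ • y, by simp [norm_smul, hpos.ne']⟩, hyW, rfl⟩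
    · rw [smul_smul, mul_inv_cancel₀ hpos.ne', one_smul]

/-- A property of almost every direction in the hemisphere holds in a dense set of directions. -/
theorem exists_mem_hemisphere_of_ae {p : Eucl (m + 1) → Prop}
    (hp : ∀ᵐ s ∂(sphereMeasure m).restrict (hemisphere m), p s) {W : Set (Eucl (m + 1))}
    (hW : IsOpen W) {s : Eucl (m + 1)} (hs : s ∈ hemisphere m) (hsW : s ∈ W) :
    ∃ t ∈ hemisphere m, t ∈ W ∧ p t := by
  rw [ae_restrict_iff' measurableSet_hemisphere] at hp
  have hW' : IsOpen (W ∩ {t | 0 < t (Fin.last m)}) :=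
    hW.inter (isOpen_lt continuous_const (by fun_prop))
  by_contra! hcon
  refine (sphereMeasure_pos_of_isOpen hW' hs.1 ⟨hsW, hs.2⟩).ne' ?_
  refine measure_eq_zero_iff_ae_notMem.2 ?_
  filter_upwards [hp, ae_norm_eq_one_sphereMeasure] with t ht ht1 htW
  exact hcon t ⟨ht1, htW.2⟩ htW.1 (ht ⟨ht1, htW.2⟩)

/-- The lines spanned by a dense set of directions of the hemisphere fill a dense set. -/
theorem dense_smul_of_ae_hemisphere {p : Eucl (m + 1) → Prop}
    (hp : ∀ᵐ s ∂(sphereMeasure m).restrict (hemisphere m), p s) :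
    Dense {t : Eucl (m + 1) |
      ∃ (a : ℝ) (s : Eucl (m + 1)), s ∈ hemisphere m ∧ p s ∧ t = a • s} := by
  refine dense_iff_inter_open.2 fun U hU ⟨t, ht⟩ => ?_
  -- move `t` off the hyperplane where the last coordinate vanishes
  obtain ⟨t', ht', h0⟩ : ∃ t' ∈ U, t' (Fin.last m) ≠ 0 := by
    have hc : Continuous fun δ : ℝ => t + δ • EuclideanSpace.single (Fin.last m) (1 : ℝ) := by
      fun_prop
    obtain ⟨δ, hδ, hδU⟩ := (dense_compl_singleton (-t (Fin.last m))).inter_open_nonempty _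
      (hU.preimage hc) ⟨0, by simpa using ht⟩
    refine ⟨_, hδ, fun h => hδU ?_⟩
    simp at h
    simp
    linarith
  have hn : ‖t'‖ ≠ 0 := by
    rw [norm_ne_zero_iff]; rintro rfl; simp at h0
  obtain ⟨a, ha, hapos⟩ : ∃ a : ℝ, |a| = ‖t'‖ ∧ 0 < a⁻¹ * t' (Fin.last m) := by
    rcases lt_or_gt_of_ne h0 with h | h
    · refine ⟨-‖t'‖, by simp, mul_pos_of_neg_of_neg (by simpa using hn) h⟩
    · exact ⟨‖t'‖, by simp, mul_pos (by positivity) h⟩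
  have ha0 : a ≠ 0 := by rintro rfl; simp at hapos
  obtain ⟨s, hs, hsU, hps⟩ := exists_mem_hemisphere_of_ae hp
    (hU.preimage (continuous_const_smul a)) (s := a⁻¹ • t')
    ⟨by rw [norm_smul, norm_inv, Real.norm_eq_abs, ha, inv_mul_cancel₀ hn], by simpa using hapos⟩
    (by simpa [smul_smul, ha0] using ht')
  exact ⟨a • s, hsU, a, s, hs, hps, rfl⟩

/-- The Fourier transform of an integrable function, in the convention of `charFun`. -/
noncomputable def fourierInner (f : Eucl (m + 1) → ℝ) (t : Eucl (m + 1)) : ℂ :=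
  ∫ g, f g • Complex.exp (inner ℝ g t * Complex.I)

theorem integrable_fourierInner {f : Eucl (m + 1) → ℝ} (hf : Integrable f) (t : Eucl (m + 1)) :
    Integrable fun g => f g • Complex.exp (inner ℝ g t * Complex.I) := by
  refine hf.smul_bdd 1 (Continuous.aestronglyMeasurable (by fun_prop)) (.of_forall fun g => ?_)
  rw [Complex.norm_exp_ofReal_mul_I]

theorem continuous_fourierInner {f : Eucl (m + 1) → ℝ} (hf : Integrable f) :
    Continuous (fourierInner f) := by
  refine continuous_of_dominated (bound := fun g => ‖f g‖)
    (fun t => (integrable_fourierInner hf t).aestronglyMeasurable) (fun t => .of_forall fun g => ?_)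
    hf.norm (.of_forall fun g => by fun_prop)
  rw [norm_smul, Complex.norm_exp_ofReal_mul_I, mul_one]

/-- Projection-slice theorem. -/
theorem fourierInner_smul {f : Eucl (m + 1) → ℝ} (hf : Integrable f) {s : Eucl (m + 1)}
    (hs : ‖s‖ = 1) (a : ℝ) :
    fourierInner f (a • s) = ∫ u, radon f s u • Complex.exp ((a * u : ℝ) * Complex.I) := by
  have he : (fun g => f g • Complex.exp (inner ℝ g (a • s) * Complex.I)) =
      fun g => f g • (fun u : ℝ => Complex.exp ((a * u : ℝ) * Complex.I)) (inner ℝ s g) := by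
    ext g
    rw [real_inner_comm, real_inner_smul_left]
  have hi := integrable_fourierInner hf (a • s)
  rw [he] at hi
  rw [fourierInner, he]
  exact integral_smul_inner_eq_integral_radon hs
    (fun u : ℝ => Complex.exp ((a * u : ℝ) * Complex.I)) hi

/-- The Fourier transform is injective on integrable functions. -/
theorem ae_eq_of_fourierInner_eq {f f' : Eucl (m + 1) → ℝ} (hf : Integrable f)
    (hf' : Integrable f') (h : fourierInner f = fourierInner f') : f =ᵐ[volume] f' := by
  -- the positive and the negative part of the difference are densities of two finite measures
  -- with the same characteristic function
  set d : Eucl (m + 1) → ℝ := fun g => f g - f' g with hd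
  have hdi : Integrable d := hf.sub hf'
  have fin₁ := isFiniteMeasure_withDensity_ofReal hdi.2
  have fin₂ := isFiniteMeasure_withDensity_ofReal hdi.neg.2
  have hm₁ : AEMeasurable (fun g => ENNReal.ofReal (d g)) :=
    hdi.aestronglyMeasurable.aemeasurable.ennreal_ofReal
  have hm₂ : AEMeasurable (fun g => ENNReal.ofReal ((-d) g)) :=
    hdi.neg.aestronglyMeasurable.aemeasurable.ennreal_ofReal
  have key : (volume : Measure (Eucl (m + 1))).withDensity (fun g => ENNReal.ofReal (d g)) =
      (volume : Measure (Eucl (m + 1))).withDensity fun g => ENNReal.ofReal ((-d) g) := by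
    refine Measure.ext_of_charFun (funext fun t => ?_)
    rw [charFun_apply, charFun_apply,
      integral_withDensity_eq_integral_toReal_smul₀ hm₁ (.of_forall fun _ => ENNReal.ofReal_lt_top),
      integral_withDensity_eq_integral_toReal_smul₀ hm₂ (.of_forall fun _ => ENNReal.ofReal_lt_top),
      ← sub_eq_zero, ← integral_sub]
    · have ht := sub_eq_zero.2 (congrFun h t)
      rw [fourierInner, fourierInner, ← integral_sub (integrable_fourierInner hf t)
        (integrable_fourierInner hf' t)] at ht
      rw [← ht]
      congr 1
      ext g
      rw [← sub_smul, ← sub_smul, ENNReal.toReal_ofReal', ENNReal.toReal_ofReal']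
      congr 1
      rcases le_total 0 (d g) with h0 | h0 <;> simp [h0] <;> rfl
    · exact integrable_fourierInner (f := fun g => (ENNReal.ofReal (d g)).toReal) (by
        simpa [ENNReal.toReal_ofReal'] using hdi.pos_part) t
    · exact integrable_fourierInner (f := fun g => (ENNReal.ofReal ((-d) g)).toReal) (by
        simpa [ENNReal.toReal_ofReal'] using hdi.neg_part) t
  have hae := (withDensity_eq_iff_of_sigmaFinite hm₁ hm₂).1 key
  filter_upwards [hae] with g hg
  have h2 := congrArg ENNReal.toReal hg
  rw [ENNReal.toReal_ofReal', ENNReal.toReal_ofReal'] at h2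
  have h3 : d g = 0 := by
    rcases le_total 0 (d g) with h0 | h0 <;> simp [h0] at h2 <;> linarith
  simpa [hd, sub_eq_zero] using h3

/-- An integrable function is determined by its Radon transform in almost all directions of the
hemisphere: the projection-slice theorem determines its Fourier transform on a dense set. -/
theorem IsRadonPreimage.ae_eq {g : Eucl (m + 1) → ℝ → ℝ} {f f' : Eucl (m + 1) → ℝ}
    (hf : IsRadonPreimage g f) (hf' : IsRadonPreimage g f') : f =ᵐ[volume] f' := by
  have hp : ∀ᵐ s ∂(sphereMeasure m).restrict (hemisphere m),
      radon f s =ᵐ[volume] radon f' s := by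
    filter_upwards [hf.2, hf'.2] with s h1 h2
    filter_upwards [h1, h2] with u hu1 hu2
    rw [hu1, hu2]
  refine ae_eq_of_fourierInner_eq hf.1 hf'.1 ?_
  refine (continuous_fourierInner hf.1).ext_on (dense_smul_of_ae_hemisphere hp)
    (continuous_fourierInner hf'.1) ?_
  rintro _ ⟨a, s, hs, hsp, rfl⟩
  rw [fourierInner_smul hf.1 hs.1, fourierInner_smul hf'.1 hs.1]
  refine integral_congr_ae ?_
  filter_upwards [hsp] with u hu
  rw [hu]

theorem IsRadonPreimage.hasRadonInverse {g : Eucl (m + 1) → ℝ → ℝ} {f : Eucl (m + 1) → ℝ}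
    (hf : IsRadonPreimage g f) : HasRadonInverse g :=
  ⟨f, hf, fun _ hf' => hf'.ae_eq hf⟩

theorem IsRadonPreimage.ae_eq_radonInv {g : Eucl (m + 1) → ℝ → ℝ} {f : Eucl (m + 1) → ℝ}
    (hf : IsRadonPreimage g f) : f =ᵐ[volume] radonInv g := by
  rw [radonInv, dif_pos hf.hasRadonInverse]
  exact hf.ae_eq hf.hasRadonInverse.choose_spec.1

end Radon

/-! ### Almost sure statements given the covariate -/

section Disintegration
variable {Ω τ ξ ω E : Type*} [MeasurableSpace Ω] [MeasurableSpace τ] [MeasurableSpace ξ]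
  [MeasurableSpace ω] {P : Measure Ω} [IsProbabilityMeasure P]

/-- An almost sure property of `(T, X)` holds, for almost every `x`, almost surely under the
conditional law of `T` given `X = x`. -/
theorem ae_ae_condDistrib_of_ae [StandardBorelSpace τ] [Nonempty τ] {T : Ω → τ} {X : Ω → ξ}
    (hT : Measurable T) (hX : Measurable X) {p : τ → ξ → Prop}
    (hp : MeasurableSet {q : ξ × τ | p q.2 q.1}) (h : ∀ᵐ a ∂P, p (T a) (X a)) :
    ∀ᵐ x ∂P.map X, ∀ᵐ t ∂condDistrib T X P x, p t x := by
  refine Measure.ae_ae_of_ae_compProd (p := fun q : ξ × τ => p q.2 q.1) ?_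
  rw [compProd_map_condDistrib hT.aemeasurable, ae_map_iff (by fun_prop) hp]
  exact h

/-- Two versions of a regression that are continuous on the support of the regressors agree
there. -/
theorem ae_eqOn_support_of_ae_eq [TopologicalSpace τ] [HereditarilyLindelofSpace τ]
    [StandardBorelSpace τ] [Nonempty τ] {T : Ω → τ} {X : Ω → ξ} (hT : Measurable T)
    (hX : Measurable X) {r r' : τ × ξ → ℝ} (hr : Measurable r) (hr' : Measurable r')
    (h : (fun a => r (T a, X a)) =ᵐ[P] fun a => r' (T a, X a))
    (hc : ∀ᵐ x ∂P.map X, ContinuousOn (fun t => r (t, x)) (condDistrib T X P x).support)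
    (hc' : ∀ᵐ x ∂P.map X, ContinuousOn (fun t => r' (t, x)) (condDistrib T X P x).support) :
    ∀ᵐ x ∂P.map X, EqOn (fun t => r (t, x)) (fun t => r' (t, x)) (condDistrib T X P x).support := by
  have h1 := ae_ae_condDistrib_of_ae (p := fun t x => r (t, x) = r' (t, x)) hT hX
    (measurableSet_eq_fun (by fun_prop) (by fun_prop)) h
  filter_upwards [h1, hc, hc'] with x h1 h2 h3
  exact eqOn_support_of_ae_eq h2 h3 h1

variable [MeasureSpace E] [TopologicalSpace E] [StandardBorelSpace E] [Nonempty E]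
    [HereditarilyLindelofSpace E] [SigmaFinite (volume : Measure E)]

/-- For a constant effect `1` the density weighted effect is the density. -/
theorem effectDensity_one_ae_eq {G : Ω → E} {X : Ω → ξ} (hG : Measurable G) (hX : Measurable X) :
    ∀ᵐ x ∂P.map X, effectDensity P (fun _ => 1) G X x =ᵐ[volume]
      fun g => ((condDistrib G X P x).rnDeriv volume g).toReal := by
  have h1 : ∀ᵐ a ∂P,
      ∫ w, w ∂condDistrib (fun _ => (1 : ℝ)) (fun a => (G a, X a)) P (G a, X a) = 1 := by
    filter_upwards [ae_of_ae_map (hG.prodMk hX).aemeasurable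
      (condDistrib_const (μ := P) (fun a => (G a, X a)) (1 : ℝ))] with a ha
    rw [ha, Kernel.deterministic_apply, integral_dirac]
  have hm : Measurable fun p : E × ξ =>
      ∫ w, w ∂condDistrib (fun _ => (1 : ℝ)) (fun a => (G a, X a)) P p :=
    (StronglyMeasurable.integral_condDistrib (f := fun q : (E × ξ) × ℝ => q.2)
      measurable_snd.stronglyMeasurable).measurable
  filter_upwards [ae_ae_condDistrib_of_ae (p := fun g x =>
    ∫ w, w ∂condDistrib (fun _ => (1 : ℝ)) (fun a => (G a, X a)) P (g, x) = 1) hG hX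
    (measurableSet_eq_fun (hm.comp measurable_swap) measurable_const) h1] with x hx
  filter_upwards [effectDensity_ae_eq (P := P) (fun _ => 1) G X x,
    Measure.ae_rnDeriv_ne_zero_imp_of_ae volume hx] with g hg1 hg2
  rw [hg1]
  by_cases h0 : (condDistrib G X P x).rnDeriv volume g = 0
  · simp [h0]
  · rw [hg2 h0, smul_eq_mul, mul_one]

/-- The density weighted effect and the density determine the effect where the density is
positive. -/
theorem ae_mean_eq_of_effectDensity_eq {Ω' : Type*} [MeasurableSpace Ω'] {P' : Measure Ω'}
    [IsProbabilityMeasure P'] (W : Ω → ℝ) (G : Ω → E) (X : Ω → ξ) (W' : Ω' → ℝ) (G' : Ω' → E)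
    (X' : Ω' → ξ) (x : ξ) :
    ∀ᵐ g : E, effectDensity P' W' G' X' x g = effectDensity P W G X x g →
      ((condDistrib G' X' P' x).rnDeriv volume g).toReal =
        ((condDistrib G X P x).rnDeriv volume g).toReal →
      0 < ((condDistrib G X P x).rnDeriv volume g).toReal →
      ∫ w, w ∂condDistrib W' (fun a => (G' a, X' a)) P' (g, x) =
        ∫ w, w ∂condDistrib W (fun a => (G a, X a)) P (g, x) := by
  filter_upwards [effectDensity_ae_eq (P := P) W G X x,
    effectDensity_ae_eq (P := P') W' G' X' x] with g h1 h2 he hd hpos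
  rw [h1, h2, hd] at he
  exact mul_left_cancel₀ hpos.ne' he

end Disintegration

/-! ### Normalized instruments -/

section AppendCoord
variable {m : ℕ}

theorem appendCoord_last (z : Eucl m) (t : ℝ) : appendCoord z t (Fin.last m) = t := by
  simp [appendCoord]

theorem inner_appendCoord (z z' : Eucl m) (t t' : ℝ) :
    inner ℝ (appendCoord z t) (appendCoord z' t') = inner ℝ z z' + t * t' := by
  simp [appendCoord, PiLp.inner_apply, Fin.sum_univ_castSucc, mul_comm]

theorem measurable_appendCoord : Measurable fun p : Eucl m × ℝ => appendCoord p.1 p.2 := by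
  unfold appendCoord
  refine (WithLp.measurable_toLp 2 _).comp (measurable_pi_lambda _ fun i => ?_)
  refine Fin.lastCases ?_ (fun i => ?_) i
  · simpa using measurable_snd
  · simp only [Fin.snoc_castSucc]; fun_prop

theorem measurable_normalizedInstruments : Measurable fun q : ℝ × Eucl m =>
    (‖appendCoord q.2 1‖⁻¹ • appendCoord q.2 1, q.1 / ‖appendCoord q.2 1‖) := by
  have h1 : Measurable fun q : ℝ × Eucl m => appendCoord q.2 1 :=
    measurable_appendCoord.comp (measurable_snd.prodMk measurable_const)
  fun_prop

theorem norm_appendCoord_one_pos (z : Eucl m) : 0 < ‖appendCoord z 1‖ := by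
  rw [norm_pos_iff]
  intro h
  have := appendCoord_last z 1
  rw [h] at this
  simp at this

end AppendCoord

/-! ### The treatment model -/

namespace TreatmentModel
variable {Ω : Type*} [MeasurableSpace Ω] {m k : ℕ}

section Model
variable (M : TreatmentModel Ω m k)

theorem measurable_D : Measurable M.D := by
  have h1 := M.measurable_V
  have h2 := M.measurable_Z
  have h3 := M.measurable_Γ
  have h4 := M.measurable_Θ
  exact Measurable.ite (measurableSet_lt measurable_const (by fun_prop)) measurable_const
    measurable_const

theorem measurable_Δ : Measurable M.Δ := M.measurable_Y₁.sub M.measurable_Y₀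

theorem measurable_Y : Measurable M.Y :=
  M.measurable_Y₀.add (M.measurable_Δ.mul M.measurable_D)

theorem measurable_X : Measurable M.X :=
  Measurable.ite (M.measurable_D (measurableSet_singleton 1)) M.measurable_X₁ M.measurable_X₀

theorem measurable_normZ : Measurable fun a => ‖appendCoord (M.Z a) 1‖ :=
  (measurable_appendCoord.comp (M.measurable_Z.prodMk measurable_const)).norm

theorem measurable_S : Measurable M.S :=
  M.measurable_normZ.inv.smul
    (measurable_appendCoord.comp (M.measurable_Z.prodMk measurable_const))

theorem measurable_Vt : Measurable M.Vt := M.measurable_V.div M.measurable_normZ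

theorem measurable_Γt : Measurable M.Γt :=
  measurable_appendCoord.comp (M.measurable_Γ.prodMk M.measurable_Θ)

theorem norm_S (a : Ω) : ‖M.S a‖ = 1 := by
  rw [S, norm_smul, norm_inv, norm_norm, inv_mul_cancel₀ (norm_appendCoord_one_pos _).ne']

theorem Y_eq_of_lt {a : Ω} (h : 0 < M.V a - inner ℝ (M.Z a) (M.Γ a) - M.Θ a) : M.Y a = M.Y₁ a := by
  simp [Y, D, Δ, h]

theorem Y_eq_of_not_lt {a : Ω} (h : ¬ 0 < M.V a - inner ℝ (M.Z a) (M.Γ a) - M.Θ a) :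
    M.Y a = M.Y₀ a := by
  simp [Y, D, h]

/-- Normalizing the instruments does not change the selection rule. -/
theorem inner_S_Γt_lt_Vt_iff (a : Ω) :
    inner ℝ (M.S a) (M.Γt a) < M.Vt a ↔ 0 < M.V a - inner ℝ (M.Z a) (M.Γ a) - M.Θ a := by
  have hp := norm_appendCoord_one_pos (M.Z a)
  rw [S, Γt, Vt, real_inner_smul_left, inner_appendCoord, lt_div_iff₀ hp, mul_right_comm,
    inv_mul_cancel₀ hp.ne']
  constructor <;> intro h <;> linarith

variable {M}

theorem FirstMoments.integrable_Y₀ (h : M.FirstMoments) : Integrable M.Y₀ M.P :=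
  Integrable.mono h M.measurable_Y₀.aestronglyMeasurable (.of_forall fun a => by
    simp only [Real.norm_eq_abs]
    rw [abs_of_nonneg (by positivity : 0 ≤ |M.Y₁ a| + |M.Y₀ a|)]
    linarith [abs_nonneg (M.Y₁ a)])

theorem FirstMoments.integrable_Y₁ (h : M.FirstMoments) : Integrable M.Y₁ M.P :=
  Integrable.mono h M.measurable_Y₁.aestronglyMeasurable (.of_forall fun a => by
    simp only [Real.norm_eq_abs]
    rw [abs_of_nonneg (by positivity : 0 ≤ |M.Y₁ a| + |M.Y₀ a|)]
    linarith [abs_nonneg (M.Y₀ a)])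

theorem FirstMoments.integrable_Y (h : M.FirstMoments) : Integrable M.Y M.P := by
  refine Integrable.mono h M.measurable_Y.aestronglyMeasurable (.of_forall fun a => ?_)
  simp only [Real.norm_eq_abs]
  rw [abs_of_nonneg (by positivity : 0 ≤ |M.Y₁ a| + |M.Y₀ a|)]
  by_cases ha : 0 < M.V a - inner ℝ (M.Z a) (M.Γ a) - M.Θ a
  · rw [M.Y_eq_of_lt ha]; linarith [abs_nonneg (M.Y₀ a)]
  · rw [M.Y_eq_of_not_lt ha]; linarith [abs_nonneg (M.Y₁ a)]

/-- Versions of the regression function, in terms of the conditional expectation given the σ-algebra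
of the regressors. -/
theorem isRegression_iff {τ : Type*} [MeasurableSpace τ] {W : Ω → ℝ} (hWi : Integrable W M.P)
    {T : Ω → τ} (hT : Measurable T) {r : τ → ℝ} :
    M.IsRegression W T r ↔ Measurable r ∧
      (fun a => r (T a)) =ᵐ[M.P] M.P[W | MeasurableSpace.comap T inferInstance] := by
  refine and_congr_right fun hr => ?_
  have hm : Measurable (M.condMean W T) :=
    (StronglyMeasurable.integral_condDistrib (f := fun q : τ × ℝ => q.2)
      measurable_snd.stronglyMeasurable).measurable
  have hc := condExp_ae_eq_integral_condDistrib' (μ := M.P) hT hWi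
  rw [ae_map_iff hT.aemeasurable (measurableSet_eq_fun hr hm)]
  constructor
  · intro h
    filter_upwards [h, hc] with a h1 h2
    rw [h1, h2]; rfl
  · intro h
    filter_upwards [h, hc] with a h1 h2
    rw [h1, h2]; rfl

theorem BaseAssumptions.absolutelyContinuous_Γt (h : M.BaseAssumptions) :
    ∀ᵐ x ∂M.lawX, M.condLaw M.Γt x ≪ volume := by
  have hm : Measurable fun ω => (M.S ω, M.Vt ω, M.Γt ω) :=
    M.measurable_S.prodMk (M.measurable_Vt.prodMk M.measurable_Γt)
  have h1 := condDistrib_comp_ae (P := M.P) M.X hm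
    (f := fun q : Eucl (m + 1) × ℝ × Eucl (m + 1) => q.2.2) (by fun_prop)
  filter_upwards [h.absCont, h1] with x hx hx1
  rw [condLaw, hx1]
  refine (hx.map (by fun_prop)).trans ?_
  exact (Measure.quasiMeasurePreserving_snd.comp Measure.quasiMeasurePreserving_snd).2

theorem BaseAssumptions.absolutelyContinuous_Θ (h : M.BaseAssumptions) :
    ∀ᵐ x ∂M.lawX, M.condLaw M.Θ x ≪ volume := by
  have h1 := condDistrib_comp_ae (P := M.P) M.X M.measurable_Γt
    (f := fun q : Eucl (m + 1) => q (Fin.last m)) (by fun_prop)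
  filter_upwards [h.absolutelyContinuous_Γt, h1] with x hx hx1
  have hΘ : M.Θ = fun a => M.Γt a (Fin.last m) :=
    funext fun a => (appendCoord_last (M.Γ a) (M.Θ a)).symm
  rw [condLaw, hΘ, hx1]
  refine (hx.map (by fun_prop)).trans ?_
  exact ((Measure.quasiMeasurePreserving_eval (fun _ : Fin (m + 1) => (volume : Measure ℝ))
    (Fin.last m)).comp (PiLp.volume_preserving_ofLp (Fin (m + 1))).quasiMeasurePreserving).2

end Model

/-! ### One instrument -/

section Scalar
variable {M : TreatmentModel Ω 0 k}

/-- The regression function is, up to a constant, the primitive of the density weighted effect. -/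
theorem BaseAssumptions.exists_primitive_one (h : M.BaseAssumptions) (hmom : M.FirstMoments) :
    ∃ r : ℝ × Eucl k → ℝ, M.IsRegression M.Y (fun ω => (M.V ω, M.X ω)) r ∧
      ∀ᵐ x ∂M.lawX, Integrable (M.ucateDensityOne x) ∧
        ∃ c, ∀ v, r (v, x) = c + ∫ u in Iio v, M.ucateDensityOne x u := by
  have hi : ∀ a, inner ℝ (M.Z a) (M.Γ a) = 0 := fun a => by
    rw [Subsingleton.elim (M.Z a) 0, inner_zero_left]
  have mA : MeasurableSet {q : ℝ × ℝ | q.2 < q.1} := measurableSet_lt (by fun_prop) (by fun_prop)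
  obtain ⟨r, hr, hrc, hx⟩ := exists_regression_eq_add_setIntegral (P := M.P) (Y := M.Y) (T := M.V)
    (G := M.Θ) (X := M.X) mA M.measurable_Y₀ M.measurable_Y₁ M.measurable_V M.measurable_Θ
    M.measurable_X hmom.integrable_Y₀ hmom.integrable_Y₁
    (fun a ha => M.Y_eq_of_lt (by rw [hi, sub_zero]; exact sub_pos.2 ha))
    (fun a ha => M.Y_eq_of_not_lt (by rw [hi, sub_zero, sub_pos]; exact ha))
    h.absolutelyContinuous_Θ
    (indepFun_condDistrib_comp (M.measurable_V.prodMk M.measurable_Z)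
      (M.measurable_Y₀.prodMk (M.measurable_Γ.prodMk M.measurable_Θ))
      (f := Prod.fst) (g := fun w : ℝ × Eucl 0 × ℝ => (w.1, w.2.2)) (by fun_prop) (by fun_prop)
      h.indep₀)
    (indepFun_condDistrib_comp (M.measurable_V.prodMk M.measurable_Z)
      (M.measurable_Y₁.prodMk (M.measurable_Γ.prodMk M.measurable_Θ))
      (f := Prod.fst) (g := fun w : ℝ × Eucl 0 × ℝ => (w.1, w.2.2)) (by fun_prop) (by fun_prop)
      h.indep₁)
  exact ⟨r, (isRegression_iff hmom.integrable_Y (M.measurable_V.prodMk M.measurable_X)).2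
    ⟨hr, hrc⟩, hx⟩

theorem BaseAssumptions.exists_isOutcomeRegressionOne (h : M.BaseAssumptions)
    (hmom : M.FirstMoments) : ∃ r, M.IsOutcomeRegressionOne r := by
  obtain ⟨r, hr, hx⟩ := h.exists_primitive_one hmom
  refine ⟨r, hr, ?_⟩
  filter_upwards [hx] with x ⟨hi, c, hc⟩
  simp only [hc]
  exact (continuous_add_integral_Iio hi c).continuousOn

/-- On the support of `V`, the density weighted effect is the derivative of any continuous version
of the regression function. -/
theorem IsOutcomeRegressionOne.ae_derivWithin (h : M.BaseAssumptions) (hmom : M.FirstMoments)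
    {r : ℝ × Eucl k → ℝ} (hr : M.IsOutcomeRegressionOne r) :
    ∀ᵐ x ∂M.lawX, ∀ᵐ θ : ℝ, θ ∈ (M.condLaw M.V x).support →
      DifferentiableWithinAt ℝ (fun v => r (v, x)) (M.condLaw M.V x).support θ ∧
      M.ucateDensityOne x θ = derivWithin (fun v => r (v, x)) (M.condLaw M.V x).support θ := by
  obtain ⟨r₀, hr₀, hx⟩ := h.exists_primitive_one hmom
  have hT := M.measurable_V.prodMk M.measurable_X
  rw [isRegression_iff hmom.integrable_Y hT] at hr₀
  have hr1 := (isRegression_iff hmom.integrable_Y hT).1 hr.1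
  have heq := ae_eqOn_support_of_ae_eq M.measurable_V M.measurable_X hr1.1 hr₀.1
    (hr1.2.trans hr₀.2.symm) hr.2 (by
      filter_upwards [hx] with x ⟨hi, c, hc⟩
      simp only [hc]
      exact (continuous_add_integral_Iio hi c).continuousOn)
  filter_upwards [hx, heq] with x ⟨hi, c, hc⟩ hE
  filter_upwards [ae_derivWithin_eq_of_eqOn_integral_Iio hi
    (f := fun v => r (v, x)) (S := (M.condLaw M.V x).support) (c := c)
    fun v hv => (hE hv).trans (hc v)] with θ hθ hmem
  exact ⟨(hθ hmem).1, (hθ hmem).2.symm⟩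

theorem IsOutcomeRegressionOne.ae_eq_dvOne (h : M.BaseAssumptions) (hmom : M.FirstMoments)
    (hls : M.LargeSupportOne) {r : ℝ × Eucl k → ℝ} (hr : M.IsOutcomeRegressionOne r) :
    ∀ᵐ x ∂M.lawX, ∀ᵐ θ : ℝ, M.ucateDensityOne x θ = M.dvOne r x θ := by
  filter_upwards [hr.ae_derivWithin h hmom, hls] with x hx hsub
  filter_upwards [hx] with θ hθ
  by_cases hmem : θ ∈ (M.condLaw M.V x).support
  · rw [(hθ hmem).2, dvOne, indicator_of_mem hmem]
  · rw [ucateDensityOne, dvOne, indicator_of_notMem hmem,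
      indicator_of_notMem fun hc => hmem (hsub hc), zero_mul]

end Scalar

/-! ### Several instruments -/

section Multivariate
variable {M : TreatmentModel Ω m k}

/-- The regression function is, up to a constant, the integral of the density weighted effect over
half spaces. -/
theorem BaseAssumptions.exists_primitive (h : M.BaseAssumptions) (hmom : M.FirstMoments) :
    ∃ r : Eucl (m + 1) × ℝ × Eucl k → ℝ,
      M.IsRegression M.Y (fun ω => (M.S ω, M.Vt ω, M.X ω)) r ∧
      ∀ᵐ x ∂M.lawX, Integrable (M.ucateDensity x) ∧
        ∃ c, ∀ s v, r (s, v, x) = c + ∫ g in {g | inner ℝ s g < v}, M.ucateDensity x g := by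
  have mA : MeasurableSet {q : (Eucl (m + 1) × ℝ) × Eucl (m + 1) | inner ℝ q.1.1 q.2 < q.1.2} :=
    measurableSet_lt (by fun_prop) (by fun_prop)
  have hg : Measurable fun w : ℝ × Eucl m × ℝ => (w.1, appendCoord w.2.1 w.2.2) :=
    measurable_fst.prodMk (measurable_appendCoord.comp measurable_snd)
  have i₀ := indepFun_condDistrib_comp (P := M.P) (X := M.X)
    (M.measurable_V.prodMk M.measurable_Z)
    (M.measurable_Y₀.prodMk (M.measurable_Γ.prodMk M.measurable_Θ))
    measurable_normalizedInstruments hg h.indep₀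
  have i₁ := indepFun_condDistrib_comp (P := M.P) (X := M.X)
    (M.measurable_V.prodMk M.measurable_Z)
    (M.measurable_Y₁.prodMk (M.measurable_Γ.prodMk M.measurable_Θ))
    measurable_normalizedInstruments hg h.indep₁
  obtain ⟨r, hr, hrc, hx⟩ := exists_regression_eq_add_setIntegral (P := M.P) (Y := M.Y)
    (T := fun a => (M.S a, M.Vt a)) (G := M.Γt) (X := M.X) mA M.measurable_Y₀ M.measurable_Y₁
    (M.measurable_S.prodMk M.measurable_Vt) M.measurable_Γt
    M.measurable_X hmom.integrable_Y₀ hmom.integrable_Y₁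
    (fun a ha => M.Y_eq_of_lt ((M.inner_S_Γt_lt_Vt_iff a).1 ha))
    (fun a ha => M.Y_eq_of_not_lt fun hc => ha ((M.inner_S_Γt_lt_Vt_iff a).2 hc))
    h.absolutelyContinuous_Γt
    i₀ i₁
  have hT : Measurable fun ω => (M.S ω, M.Vt ω, M.X ω) :=
    M.measurable_S.prodMk (M.measurable_Vt.prodMk M.measurable_X)
  -- bracketing the regressors differently leaves the generated σ-algebra unchanged
  have hcomap : MeasurableSpace.comap (fun ω => (M.S ω, M.Vt ω, M.X ω)) inferInstance =
      MeasurableSpace.comap (fun ω => ((M.S ω, M.Vt ω), M.X ω)) inferInstance := by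
    have := (MeasurableEquiv.prodAssoc :
      (Eucl (m + 1) × ℝ) × Eucl k ≃ᵐ Eucl (m + 1) × ℝ × Eucl k).measurableEmbedding.comap_eq
    rw [← this, MeasurableSpace.comap_comp]
    rfl
  refine ⟨fun q => r ((q.1, q.2.1), q.2.2), (isRegression_iff hmom.integrable_Y hT).2
    ⟨by fun_prop, by rw [hcomap]; exact hrc⟩, ?_⟩
  filter_upwards [hx] with x ⟨hi, c, hc⟩
  exact ⟨hi, c, fun s v => hc (s, v)⟩

theorem ae_instrSupport_subset : ∀ᵐ x ∂M.lawX, ∀ q ∈ M.instrSupport x, ‖q.1‖ = 1 := by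
  have h1 := ae_ae_condDistrib_of_ae (P := M.P) (p := fun (q : Eucl (m + 1) × ℝ) _ => ‖q.1‖ = 1)
    (M.measurable_S.prodMk M.measurable_Vt) M.measurable_X
    (measurableSet_eq_fun (by fun_prop) measurable_const) (.of_forall M.norm_S)
  filter_upwards [h1] with x hx
  exact Measure.support_subset_of_isClosed
    (isClosed_eq (by fun_prop) continuous_const) hx

theorem continuousOn_primitive {f : Eucl (m + 1) → ℝ} (hf : Integrable f)
    {K : Set (Eucl (m + 1) × ℝ)} (hK : ∀ q ∈ K, ‖q.1‖ = 1) (c : ℝ) :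
    ContinuousOn (fun q : Eucl (m + 1) × ℝ => c + ∫ g in {g | inner ℝ q.1 g < q.2}, f g) K :=
  fun q hq => (continuousAt_const.add
    (continuousAt_setIntegral_halfSpace hf (hK q hq))).continuousWithinAt

theorem BaseAssumptions.exists_isOutcomeRegression (h : M.BaseAssumptions)
    (hmom : M.FirstMoments) : ∃ r, M.IsOutcomeRegression r := by
  obtain ⟨r, hr, hx⟩ := h.exists_primitive hmom
  refine ⟨r, hr, ?_⟩
  filter_upwards [hx, ae_instrSupport_subset] with x ⟨hi, c, hc⟩ hK
  simp only [hc]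
  exact continuousOn_primitive hi hK c

/-- Any continuous version of the regression function is, on the support of the instruments and up
to a constant, the integral of the density weighted effect over half spaces. -/
theorem IsOutcomeRegression.ae_eq_primitive (h : M.BaseAssumptions) (hmom : M.FirstMoments)
    {r : Eucl (m + 1) × ℝ × Eucl k → ℝ} (hr : M.IsOutcomeRegression r) :
    ∀ᵐ x ∂M.lawX, Integrable (M.ucateDensity x) ∧ ∃ c, ∀ q ∈ M.instrSupport x,
      r (q.1, q.2, x) = c + ∫ g in {g | inner ℝ q.1 g < q.2}, M.ucateDensity x g := by
  obtain ⟨r₀, hr₀, hx⟩ := h.exists_primitive hmom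
  have hT : Measurable fun ω => (M.S ω, M.Vt ω, M.X ω) :=
    M.measurable_S.prodMk (M.measurable_Vt.prodMk M.measurable_X)
  rw [isRegression_iff hmom.integrable_Y hT] at hr₀
  have hr1 := (isRegression_iff hmom.integrable_Y hT).1 hr.1
  have m1 := hr1.1
  have m0 := hr₀.1
  have heq := ae_eqOn_support_of_ae_eq (P := M.P) (X := M.X)
    (T := fun a => (M.S a, M.Vt a)) (M.measurable_S.prodMk M.measurable_Vt)
    M.measurable_X (r := fun p => r (p.1.1, p.1.2, p.2)) (r' := fun p => r₀ (p.1.1, p.1.2, p.2))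
    (by fun_prop) (by fun_prop) (hr1.2.trans hr₀.2.symm) hr.2 (by
      filter_upwards [hx, ae_instrSupport_subset] with x ⟨hi, c, hc⟩ hK
      simp only [hc]
      exact continuousOn_primitive hi hK c)
  filter_upwards [hx, heq] with x ⟨hi, c, hc⟩ hE
  exact ⟨hi, c, fun q hq => (hE hq).trans (hc _ _)⟩

/-- Under large support, every index value strictly between two values taken on the support of the
coefficients lies in the section of the support of the instruments, for every direction of the
hemisphere: the directions for which the assumption holds are dense, and nearby directions take
nearby index values. -/
theorem LargeSupport.mem_instrSection (hls : M.LargeSupport) :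
    ∀ᵐ x ∂M.lawX, ∀ s ∈ hemisphere m, ∀ v : ℝ, ∀ γ₁ ∈ (M.condLaw M.Γt x).support,
      ∀ γ₂ ∈ (M.condLaw M.Γt x).support, inner ℝ s γ₁ < v → v < inner ℝ s γ₂ →
        v ∈ M.instrSection s x := by
  have hch := condDistrib_prodMk_ae_eq_compProd (P := M.P) M.measurable_S M.measurable_Vt
    M.measurable_X
  filter_upwards [hls, hch] with x ⟨hsupp, hrange⟩ hc s hs v γ₁ h₁ γ₂ h₂ hlt₁ hlt₂
  refine (Measure.mem_support_iff_forall _).2 fun N hN => ?_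
  obtain ⟨U, W, hU, hsU, hW, hvW, hUW⟩ := mem_nhds_prod_iff'.1 hN
  set U' : Set (Eucl (m + 1)) := U ∩ ({t | inner ℝ t γ₁ < v} ∩ {t | v < inner ℝ t γ₂}) with hU'
  have hU'o : IsOpen U' := hU.inter ((isOpen_lt (by fun_prop) continuous_const).inter
    (isOpen_lt continuous_const (by fun_prop)))
  have hpos : 0 < M.condLaw M.S x U' :=
    (Measure.mem_support_iff_forall s).1 (hsupp ▸ subset_closure hs) U'
      (hU'o.mem_nhds ⟨hsU, hlt₁, hlt₂⟩)
  have hsub : U' ×ˢ W ⊆ N := (prod_mono_left inter_subset_left).trans hUW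
  refine lt_of_lt_of_le ?_ (measure_mono hsub)
  have hm : Measurable fun b => (condDistrib M.Vt (fun a => (M.S a, M.X a)) M.P).comap Prod.swap
      measurable_swap (x, b) W :=
    (Kernel.measurable_coe _ hW.measurableSet).comp measurable_prodMk_left
  rw [condLaw, hc, pos_iff_ne_zero, ne_eq,
    Kernel.compProd_apply_prod hU'o.measurableSet hW.measurableSet, lintegral_eq_zero_iff hm]
  intro h0
  refine hpos.ne' (measure_eq_zero_iff_ae_notMem.2 ?_)
  filter_upwards [hrange, (ae_restrict_iff' hU'o.measurableSet).1 h0] with t ht ht0 htU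
  have hv : v ∈ M.indexRange t x :=
    ⟨iInf₂_le_of_le γ₁ h₁ (EReal.coe_le_coe_iff.2 htU.2.1.le),
      le_iSup₂_of_le γ₂ h₂ (EReal.coe_le_coe_iff.2 htU.2.2.le)⟩
  exact ((Measure.mem_support_iff_forall v).1 (ht hv) W (hW.mem_nhds hvW)).ne' (ht0 htU)

/-- Outside the section of the support of the instruments the Radon transform of the density
weighted effect vanishes, except at the two extreme index values. -/
theorem LargeSupport.ae_radon_eq_zero (hls : M.LargeSupport) :
    ∀ᵐ x ∂M.lawX, ∀ s ∈ hemisphere m, ∀ᵐ v : ℝ, v ∉ M.instrSection s x →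
      radon (M.ucateDensity x) s v = 0 := by
  filter_upwards [hls.mem_instrSection] with x hx s hs
  set K := (M.condLaw M.Γt x).support with hK
  have hL : {v : ℝ | IsLeast ((fun γ => (inner ℝ s γ : ℝ)) '' K) v}.Subsingleton :=
    fun a ha b hb => ha.unique hb
  have hG : {v : ℝ | IsGreatest ((fun γ => (inner ℝ s γ : ℝ)) '' K) v}.Subsingleton :=
    fun a ha b hb => ha.unique hb
  filter_upwards [measure_eq_zero_iff_ae_notMem.1 (hL.measure_zero volume),
    measure_eq_zero_iff_ae_notMem.1 (hG.measure_zero volume)] with v hvL hvG hv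
  rw [radon]
  refine integral_eq_zero_of_ae (.of_forall fun w => ?_)
  have hw : v • s + (w : Eucl (m + 1)) ∉ K := by
    intro hmem
    have hin : inner ℝ s (v • s + (w : Eucl (m + 1))) = v := inner_smul_add_orthogonal hs.1 v w
    have h1 : ∃ γ₁ ∈ K, inner ℝ s γ₁ < v := by
      by_contra! hcon
      exact hvL ⟨⟨_, hmem, hin⟩, by rintro _ ⟨γ, hγ, rfl⟩; exact hcon γ hγ⟩
    have h2 : ∃ γ₂ ∈ K, v < inner ℝ s γ₂ := by
      by_contra! hcon
      exact hvG ⟨⟨_, hmem, hin⟩, by rintro _ ⟨γ, hγ, rfl⟩; exact hcon γ hγ⟩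
    obtain ⟨γ₁, hγ₁, hl₁⟩ := h1
    obtain ⟨γ₂, hγ₂, hl₂⟩ := h2
    exact hv (hx s hs v γ₁ hγ₁ γ₂ hγ₂ hl₁ hl₂)
  simp only [ucateDensity, Pi.zero_apply]
  rw [indicator_of_notMem hw, zero_mul]

/-- The derivative of the regression function, extended by `0`, is the Radon transform of the
density weighted effect. -/
theorem IsOutcomeRegression.ae_isRadonPreimage (h : M.BaseAssumptions) (hmom : M.FirstMoments)
    (hls : M.LargeSupport) {r : Eucl (m + 1) × ℝ × Eucl k → ℝ} (hr : M.IsOutcomeRegression r) :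
    ∀ᵐ x ∂M.lawX,
      (∀ s ∈ hemisphere m, ∀ᵐ v : ℝ, v ∈ M.instrSection s x →
        DifferentiableWithinAt ℝ (fun v => r (s, v, x)) (M.instrSection s x) v) ∧
      IsRadonPreimage (M.dv r x) (M.ucateDensity x) := by
  filter_upwards [hr.ae_eq_primitive h hmom, hls.ae_radon_eq_zero] with x ⟨hi, c, hc⟩ hx
  have hd : ∀ s ∈ hemisphere m, ∀ᵐ v : ℝ, v ∈ M.instrSection s x →
      DifferentiableWithinAt ℝ (fun v => r (s, v, x)) (M.instrSection s x) v ∧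
      derivWithin (fun v => r (s, v, x)) (M.instrSection s x) v =
        radon (M.ucateDensity x) s v := fun s hs =>
    ae_derivWithin_eq_of_eqOn_integral_Iio (integrable_radon hi hs.1) (c := c) fun v hv => by
      rw [hc (s, v) hv, setIntegral_halfSpace_eq_integral_radon hi hs.1]
  refine ⟨fun s hs => (hd s hs).mono fun v hv hmem => (hv hmem).1, hi, ?_⟩
  refine (ae_restrict_iff' measurableSet_hemisphere).2 (.of_forall fun s hs => ?_)
  filter_upwards [hd s hs, hx s hs] with v hv hv0
  by_cases hmem : v ∈ M.instrSection s x
  · rw [dv, indicator_of_mem hmem, (hv hmem).2]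
  · rw [dv, indicator_of_notMem hmem, hv0 hmem]

end Multivariate

variable {Ω' : Type*} [MeasurableSpace Ω']

/-! ### Functions of the law of the observables -/

section Observables
variable {M : TreatmentModel Ω m k} {M' : TreatmentModel Ω' m k}

theorem measurable_observables (M : TreatmentModel Ω m k) :
    Measurable fun ω => (M.Y ω, M.D ω, M.V ω, M.Z ω, M.X ω) :=
  M.measurable_Y.prodMk (M.measurable_D.prodMk (M.measurable_V.prodMk
    (M.measurable_Z.prodMk M.measurable_X)))

/-- Equality of the laws of the observables passes to measurable functions of the observables. -/
theorem map_eq_of_lawObs_eq (h : M'.lawObs = M.lawObs) {β : Type*} [MeasurableSpace β]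
    {F : ℝ × ℝ × ℝ × Eucl m × Eucl k → β} (hF : Measurable F) :
    M'.P.map (fun ω => F (M'.Y ω, M'.D ω, M'.V ω, M'.Z ω, M'.X ω)) =
      M.P.map (fun ω => F (M.Y ω, M.D ω, M.V ω, M.Z ω, M.X ω)) := by
  have := congrArg (Measure.map F) h
  rwa [lawObs, lawObs, Measure.map_map hF M'.measurable_observables,
    Measure.map_map hF M.measurable_observables] at this

theorem lawX_eq_of_lawObs_eq (h : M'.lawObs = M.lawObs) : M'.lawX = M.lawX :=
  map_eq_of_lawObs_eq h (F := fun q => q.2.2.2.2) (by fun_prop)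

theorem IsRegression.congr {τ : Type*} [MeasurableSpace τ] {T : Ω → τ} {T' : Ω' → τ}
    {W : Ω → ℝ} {W' : Ω' → ℝ} (hT : Measurable T) (hW : Measurable W) (hT' : Measurable T')
    (hW' : Measurable W')
    (h : M'.P.map (fun ω => (T' ω, W' ω)) = M.P.map (fun ω => (T ω, W ω))) {r : τ → ℝ}
    (hr : M.IsRegression W T r) : M'.IsRegression W' T' r := by
  refine ⟨hr.1, ?_⟩
  have hTT : M'.P.map T' = M.P.map T := by
    have := congrArg (Measure.map Prod.fst) h
    rwa [Measure.map_map (by fun_prop) (by fun_prop),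
      Measure.map_map (by fun_prop) (by fun_prop)] at this
  rw [hTT]
  filter_upwards [hr.2, condDistrib_congr_of_map_eq hW hT hW' hT' h] with t h1 h2
  rw [h1, condMean, condMean, h2]

theorem ae_condLaw_V_eq (h : M'.lawObs = M.lawObs) :
    ∀ᵐ x ∂M.lawX, M'.condLaw M'.V x = M.condLaw M.V x :=
  condDistrib_congr_of_map_eq M.measurable_V M.measurable_X M'.measurable_V M'.measurable_X
    (map_eq_of_lawObs_eq h (F := fun q => (q.2.2.2.2, q.2.2.1)) (by fun_prop))

theorem ae_condLaw_instruments_eq (h : M'.lawObs = M.lawObs) :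
    ∀ᵐ x ∂M.lawX, M'.condLaw (fun ω => (M'.S ω, M'.Vt ω)) x =
      M.condLaw (fun ω => (M.S ω, M.Vt ω)) x := by
  have hmap := map_eq_of_lawObs_eq h (F := fun q => (q.2.2.2.2,
      (‖appendCoord q.2.2.2.1 1‖⁻¹ • appendCoord q.2.2.2.1 1,
        q.2.2.1 / ‖appendCoord q.2.2.2.1 1‖))) (by
    have h1 := measurable_normalizedInstruments.comp (by fun_prop :
      Measurable fun q : ℝ × ℝ × ℝ × Eucl m × Eucl k => (q.2.2.1, q.2.2.2.1))
    exact Measurable.prodMk (by fun_prop) h1)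
  exact condDistrib_congr_of_map_eq (M.measurable_S.prodMk M.measurable_Vt) M.measurable_X
    (M'.measurable_S.prodMk M'.measurable_Vt) M'.measurable_X hmap

theorem IsOutcomeRegressionOne.of_lawObs_eq (h : M'.lawObs = M.lawObs) {r : ℝ × Eucl k → ℝ}
    (hr : M.IsOutcomeRegressionOne r) : M'.IsOutcomeRegressionOne r := by
  refine ⟨hr.1.congr (M.measurable_V.prodMk M.measurable_X) M.measurable_Y
    (M'.measurable_V.prodMk M'.measurable_X) M'.measurable_Y
    (map_eq_of_lawObs_eq h (F := fun q => ((q.2.2.1, q.2.2.2.2), q.1)) (by fun_prop)), ?_⟩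
  rw [lawX_eq_of_lawObs_eq h]
  filter_upwards [hr.2, ae_condLaw_V_eq h] with x h1 h2
  rwa [h2]

theorem IsOutcomeRegression.of_lawObs_eq (h : M'.lawObs = M.lawObs)
    {r : Eucl (m + 1) × ℝ × Eucl k → ℝ} (hr : M.IsOutcomeRegression r) :
    M'.IsOutcomeRegression r := by
  have hmap := map_eq_of_lawObs_eq h (F := fun q =>
      ((‖appendCoord q.2.2.2.1 1‖⁻¹ • appendCoord q.2.2.2.1 1,
        q.2.2.1 / ‖appendCoord q.2.2.2.1 1‖, q.2.2.2.2), q.1)) (by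
    have h1 := measurable_normalizedInstruments.comp (by fun_prop :
      Measurable fun q : ℝ × ℝ × ℝ × Eucl m × Eucl k => (q.2.2.1, q.2.2.2.1))
    exact (h1.fst.prodMk (h1.snd.prodMk (by fun_prop))).prodMk measurable_fst)
  refine ⟨hr.1.congr (M.measurable_S.prodMk (M.measurable_Vt.prodMk M.measurable_X))
    M.measurable_Y (M'.measurable_S.prodMk (M'.measurable_Vt.prodMk M'.measurable_X))
    M'.measurable_Y hmap, ?_⟩
  rw [lawX_eq_of_lawObs_eq h]
  filter_upwards [hr.2, ae_condLaw_instruments_eq h] with x h1 h2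
  rwa [instrSupport, h2]

end Observables

/-! ### The model with unit effect -/

section UnitEffect

/-- The model with the same selection mechanism in which the outcome is the treatment status. Its
effect is constantly `1`, so its density weighted effect is the density of the coefficients. -/
noncomputable def unitEffect (M : TreatmentModel Ω m k) : TreatmentModel Ω m k :=
  { M with
    Y₀ := fun _ => 0
    Y₁ := fun _ => 1
    measurable_Y₀ := measurable_const
    measurable_Y₁ := measurable_const }

variable {M : TreatmentModel Ω m k} {M' : TreatmentModel Ω' m k}

theorem unitEffect_Δ : M.unitEffect.Δ = fun _ => 1 := by
  ext a; simp [Δ, unitEffect]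

theorem unitEffect_Y : M.unitEffect.Y = M.D := by
  ext a
  have : M.unitEffect.D a = M.D a := rfl
  simp [Y, unitEffect_Δ, this]
  rfl

theorem BaseAssumptions.unitEffect (h : M.BaseAssumptions) : M.unitEffect.BaseAssumptions := by
  have i₀ := indepFun_condDistrib_comp (P := M.P) (X := M.X)
    (M.measurable_V.prodMk M.measurable_Z)
    (M.measurable_Y₀.prodMk (M.measurable_Γ.prodMk M.measurable_Θ)) measurable_id
    (g := fun w : ℝ × Eucl m × ℝ => ((0 : ℝ), w.2)) (by fun_prop) h.indep₀
  have i₁ := indepFun_condDistrib_comp (P := M.P) (X := M.X)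
    (M.measurable_V.prodMk M.measurable_Z)
    (M.measurable_Y₁.prodMk (M.measurable_Γ.prodMk M.measurable_Θ)) measurable_id
    (g := fun w : ℝ × Eucl m × ℝ => ((1 : ℝ), w.2)) (by fun_prop) h.indep₁
  exact ⟨h.absCont, i₀, i₁, h.score, h.covariates⟩

theorem firstMoments_unitEffect : M.unitEffect.FirstMoments :=
  integrable_const (μ := M.P) (|(1 : ℝ)| + |(0 : ℝ)|)

theorem lawObs_unitEffect_eq (h : M'.lawObs = M.lawObs) :
    M'.unitEffect.lawObs = M.unitEffect.lawObs := by
  rw [lawObs, lawObs, unitEffect_Y, unitEffect_Y]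
  exact map_eq_of_lawObs_eq h (F := fun q => (q.2.1, q.2.1, q.2.2.1, q.2.2.2.1, q.2.2.2.2))
    (by fun_prop)

theorem ae_ucateDensityOne_unitEffect :
    ∀ᵐ x ∂M.lawX, M.unitEffect.ucateDensityOne x =ᵐ[volume] M.condDensity M.Θ x := by
  have h := effectDensity_one_ae_eq (P := M.P) M.measurable_Θ M.measurable_X
  rw [← unitEffect_Δ (M := M)] at h
  exact h

theorem ae_ucateDensity_unitEffect :
    ∀ᵐ x ∂M.lawX, M.unitEffect.ucateDensity x =ᵐ[volume] M.condDensity M.Γt x := by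
  have h := effectDensity_one_ae_eq (P := M.P) M.measurable_Γt M.measurable_X
  rw [← unitEffect_Δ (M := M)] at h
  exact h

end UnitEffect

/-! ### Identification -/

section Identification

/-- The density weighted effect is identified: the regression function and the support of `V` are
those of the observables. -/
theorem ae_ucateDensityOne_eq {M : TreatmentModel Ω 0 k} {M' : TreatmentModel Ω' 0 k}
    (h : M.BaseAssumptions) (hm : M.FirstMoments) (h' : M'.BaseAssumptions)
    (hm' : M'.FirstMoments) (hobs : M'.lawObs = M.lawObs) :
    ∀ᵐ x ∂M.lawX, ∀ᵐ θ : ℝ, θ ∈ (M.condLaw M.V x).support →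
      M'.ucateDensityOne x θ = M.ucateDensityOne x θ := by
  obtain ⟨r, hr⟩ := h.exists_isOutcomeRegressionOne hm
  have h2 := (hr.of_lawObs_eq hobs).ae_derivWithin h' hm'
  rw [lawX_eq_of_lawObs_eq hobs] at h2
  filter_upwards [hr.ae_derivWithin h hm, h2, ae_condLaw_V_eq hobs] with x h1 h2 h3
  rw [h3] at h2
  filter_upwards [h1, h2] with θ h1 h2 hθ
  rw [(h1 hθ).2, (h2 hθ).2]

/-- The density weighted effect is identified: in both models it has the same Radon transform. -/
theorem ae_ucateDensity_eq {M : TreatmentModel Ω m k} {M' : TreatmentModel Ω' m k}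
    (h : M.BaseAssumptions) (hm : M.FirstMoments) (hls : M.LargeSupport)
    (h' : M'.BaseAssumptions) (hm' : M'.FirstMoments) (hls' : M'.LargeSupport)
    (hobs : M'.lawObs = M.lawObs) :
    ∀ᵐ x ∂M.lawX, ∀ᵐ γ : Eucl (m + 1), M'.ucateDensity x γ = M.ucateDensity x γ := by
  obtain ⟨r, hr⟩ := h.exists_isOutcomeRegression hm
  have h2 := (hr.of_lawObs_eq hobs).ae_isRadonPreimage h' hm' hls'
  rw [lawX_eq_of_lawObs_eq hobs] at h2
  filter_upwards [hr.ae_isRadonPreimage h hm hls, h2, ae_condLaw_instruments_eq hobs]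
    with x h1 h2 h3
  have hdv : M'.dv r x = M.dv r x := by
    have hs : M'.instrSupport x = M.instrSupport x := by rw [instrSupport, h3]; rfl
    unfold dv instrSection
    rw [hs]
  exact (hdv ▸ h2.2).ae_eq h1.2

theorem identified_one {M : TreatmentModel Ω 0 k} {M' : TreatmentModel Ω' 0 k}
    (h : M.BaseAssumptions) (hm : M.FirstMoments) (h' : M'.BaseAssumptions)
    (hm' : M'.FirstMoments) (hobs : M'.lawObs = M.lawObs) :
    ∀ᵐ x ∂M.lawX, ∀ᵐ θ : ℝ, θ ∈ (M.condLaw M.V x).support →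
      M'.condDensity M'.Θ x θ = M.condDensity M.Θ x θ ∧
      (0 < M.condDensity M.Θ x θ → M'.ucateOne θ x = M.ucateOne θ x) := by
  have e' := ae_ucateDensityOne_unitEffect (M := M')
  rw [lawX_eq_of_lawObs_eq hobs] at e'
  filter_upwards [ae_ucateDensityOne_eq h hm h' hm' hobs,
    ae_ucateDensityOne_eq (M := M.unitEffect) (M' := M'.unitEffect) h.unitEffect
      firstMoments_unitEffect h'.unitEffect firstMoments_unitEffect (lawObs_unitEffect_eq hobs),
    ae_ucateDensityOne_unitEffect (M := M), e'] with x h1 h2 h3 h4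
  filter_upwards [h1, h2, h3, h4, ae_mean_eq_of_effectDensity_eq (P := M.P) (P' := M'.P) M.Δ M.Θ
    M.X M'.Δ M'.Θ M'.X x] with θ h1 h2 h3 h4 h5 hθ
  have hd : M'.condDensity M'.Θ x θ = M.condDensity M.Θ x θ := by
    rw [← h3, ← h4]; exact h2 hθ
  exact ⟨hd, h5 (h1 hθ) hd⟩

theorem identified {M : TreatmentModel Ω m k} {M' : TreatmentModel Ω' m k}
    (h : M.BaseAssumptions) (hm : M.FirstMoments) (hls : M.LargeSupport)
    (h' : M'.BaseAssumptions) (hm' : M'.FirstMoments) (hls' : M'.LargeSupport)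
    (hobs : M'.lawObs = M.lawObs) :
    ∀ᵐ x ∂M.lawX, ∀ᵐ γ : Eucl (m + 1),
      M'.condDensity M'.Γt x γ = M.condDensity M.Γt x γ ∧
      (0 < M.condDensity M.Γt x γ → M'.ucate γ x = M.ucate γ x) := by
  have e' := ae_ucateDensity_unitEffect (M := M')
  rw [lawX_eq_of_lawObs_eq hobs] at e'
  filter_upwards [ae_ucateDensity_eq h hm hls h' hm' hls' hobs,
    ae_ucateDensity_eq (M := M.unitEffect) (M' := M'.unitEffect) h.unitEffect
      firstMoments_unitEffect hls h'.unitEffect firstMoments_unitEffect hls'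
      (lawObs_unitEffect_eq hobs),
    ae_ucateDensity_unitEffect (M := M), e'] with x h1 h2 h3 h4
  filter_upwards [h1, h2, h3, h4, ae_mean_eq_of_effectDensity_eq (P := M.P) (P' := M'.P) M.Δ M.Γt
    M.X M'.Δ M'.Γt M'.X x] with γ h1 h2 h3 h4 h5
  have hd : M'.condDensity M'.Γt x γ = M.condDensity M.Γt x γ := by
    rw [← h3, ← h4]; exact h2
  exact ⟨hd, h5 h1 hd⟩

end Identification
end TreatmentModel

theorem theorem2 {Ω : Type*} [MeasurableSpace Ω] {m k : ℕ} (M : TreatmentModel Ω m k)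
    (hbase : M.BaseAssumptions) (hmom : M.FirstMoments) :
    -- the case `L = 1`
    (m = 0 →
      (∃ r, M.IsOutcomeRegressionOne r) ∧
      (∀ r, M.IsOutcomeRegressionOne r → ∀ᵐ x ∂M.lawX,
        (∀ᵐ θ : ℝ, θ ∈ (M.condLaw M.V x).support →
          DifferentiableWithinAt ℝ (fun v => r (v, x)) (M.condLaw M.V x).support θ ∧
          M.ucateDensityOne x θ = derivWithin (fun v => r (v, x)) (M.condLaw M.V x).support θ)) ∧
      (M.LargeSupportOne → ∀ r, M.IsOutcomeRegressionOne r → ∀ᵐ x ∂M.lawX,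
        ∀ᵐ θ : ℝ, M.ucateDensityOne x θ = M.dvOne r x θ) ∧
      -- identification of `UCATE`
      (∀ (Ω' : Type*) [MeasurableSpace Ω'] (M' : TreatmentModel Ω' m k),
        M'.BaseAssumptions → M'.FirstMoments → M'.lawObs = M.lawObs →
        ∀ᵐ x ∂M.lawX, ∀ᵐ θ : ℝ, θ ∈ (M.condLaw M.V x).support →
          M'.condDensity M'.Θ x θ = M.condDensity M.Θ x θ ∧
          (0 < M.condDensity M.Θ x θ → M'.ucateOne θ x = M.ucateOne θ x))) ∧
    -- the case `L ≥ 2`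
    (1 ≤ m → M.LargeSupport →
      (∃ r, M.IsOutcomeRegression r) ∧
      (∀ r, M.IsOutcomeRegression r → ∀ᵐ x ∂M.lawX,
        (∀ s ∈ hemisphere m, ∀ᵐ v : ℝ, v ∈ M.instrSection s x →
          DifferentiableWithinAt ℝ (fun v => r (s, v, x)) (M.instrSection s x) v) ∧
        HasRadonInverse (M.dv r x) ∧
        ∀ᵐ γ : Eucl (m + 1), M.ucateDensity x γ = radonInv (M.dv r x) γ) ∧
      -- identification of `UCATE`
      (∀ (Ω' : Type*) [MeasurableSpace Ω'] (M' : TreatmentModel Ω' m k),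
        M'.BaseAssumptions → M'.FirstMoments → M'.LargeSupport → M'.lawObs = M.lawObs →
        ∀ᵐ x ∂M.lawX, ∀ᵐ γ : Eucl (m + 1),
          M'.condDensity M'.Γt x γ = M.condDensity M.Γt x γ ∧
          (0 < M.condDensity M.Γt x γ → M'.ucate γ x = M.ucate γ x))) := by
  refine ⟨?_, fun _ hls => ⟨hbase.exists_isOutcomeRegression hmom, fun r hr => ?_,
    fun Ω' _ M' h' hm' hls' hobs => TreatmentModel.identified hbase hmom hls h' hm' hls' hobs⟩⟩
  · rintro rfl
    exact ⟨hbase.exists_isOutcomeRegressionOne hmom,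
      fun r hr => hr.ae_derivWithin hbase hmom,
      fun hls r hr => hr.ae_eq_dvOne hbase hmom hls,
      fun Ω' _ M' h' hm' hobs => TreatmentModel.identified_one hbase hmom h' hm' hobs⟩
  · filter_upwards [hr.ae_isRadonPreimage hbase hmom hls] with x hx
    exact ⟨hx.1, hx.2.hasRadonInverse, hx.2.ae_eq_radonInv⟩
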